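/- **Trace inequality.** Let $\kappa_{\max}\in\mathbb{R}$ and $c_\Gamma>0$. There is a constant $c_\kappa>0$, depending only on $\kappa_{\max}$ and $c_\Gamma$, such that the following holds. Let $\mathbb{T}=\mathbb{R}/\mathbb{Z}$, and let $\boldsymbol{X}:\mathbb{T}\to\mathbb{R}^3$ be a closed $C^2$ curve parametrized by arclength (so of length $1$), with curvature $|\boldsymbol{X}''|\le\kappa_{\max}$ and with $|\boldsymbol{X}(s)-\boldsymbol{X}(t)|\ge c_\Gamma|s-t|$ for all $s,t\in\mathbb{T}$, where $|s-t|$ is the distance on $\mathbb{T}$. Let $\boldsymbol{e}_{n_1},\boldsymbol{e}_{n_2}\in C^1(\mathbb{T};\mathbb{R}^3)$ be such that $(\boldsymbol{X}',\boldsymbol{e}_{n_1},\boldsymbol{e}_{n_2})$ is orthonormal at every $s$, and put $\boldsymbol{e}_\rho(s,\theta)=\cos\theta\,\boldsymbol{e}_{n_1}(s)+\sin\theta\,\boldsymbol{e}_{n_2}(s)$. Let $r_{\max}>0$ be such that every point at distance less than $r_{\max}$ from the curve can be written as $\boldsymbol{X}(s)+\rho\,\boldsymbol{e}_\rho(s,\theta)$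 with $0\le\rho<r_{\max}$ for exactly one $s\in\mathbb{T}$. Let $0<\epsilon<r_{\max}/4$, and let $$\Sigma_\epsilon=\{\boldsymbol{X}(s)+\rho\,\boldsymbol{e}_\rho(s,\theta): s\in\mathbb{T},\ \theta\in\mathbb{R},\ 0\le\rho<\epsilon\},\qquad \Omega_\epsilon=\mathbb{R}^3\setminus\overline{\Sigma_\epsilon},\qquad \Gamma_\epsilon=\partial\Sigma_\epsilon .$$ Let $D^{1,2}(\Omega_\epsilon)$ be the space of vector fields $\boldsymbol{u}\in L^6(\Omega_\epsilon;\mathbb{R}^3)$ whose weak gradient $\nabla\boldsymbol{u}$ is in $L^2(\Omega_\epsilon)$, with norm $\|\nabla\boldsymbol{u}\|_{L^2(\Omega_\epsilon)}$. The trace operator of $D^{1,2}(\Omega_\epsilon)$ into $L^2(\Gamma_\epsilon)$ is the continuous extension, by density, of the restriction $\boldsymbol{v}\mapsto\boldsymbol{v}|_{\Gamma_\epsilon}$ of the fields $\boldsymbol{v}\in D^{1,2}(\Omega_\epsilon)\cap C^1(\Omega_\epsilon)\cap C^0(\overline{\Omega_\epsilon})$. Let $\boldsymbol{u}\in D^{1,2}(\Omega_\epsilon)$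 have a trace on $\Gamma_\epsilon$ that is independent of $\theta$, i.e. the trace at $\boldsymbol{X}(s)+\epsilon\,\boldsymbol{e}_\rho(s,\theta)$ equals $\mathrm{Tr}(\boldsymbol{u})(s)$ for almost every $(s,\theta)$, for a function $\mathrm{Tr}(\boldsymbol{u})$ on $\mathbb{T}$. Then $$\|\mathrm{Tr}(\boldsymbol{u})\|_{L^2(\mathbb{T})}\le c_\kappa\,|\log\epsilon|^{1/2}\,\|\nabla\boldsymbol{u}\|_{L^2(\Omega_\epsilon)} .$$ -/

import Mathlib

open MeasureTheory Filter Set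
open scoped Topology ContDiff ENNReal

noncomputable section

namespace SlenderBody

/-- Three-dimensional Euclidean space `ℝ³`. -/
abbrev E3 : Type := EuclideanSpace ℝ (Fin 3)

/-- The centerlines: closed `C²` curves `X : ℝ/ℤ → ℝ³` (written as `1`-periodic functions on `ℝ`),
parametrized by arclength (so of length `1`), of curvature at most `κmax`, with
`|X(s) - X(t)| ≥ cΓ |s - t|`, where `|s - t|` is the distance on the circle `ℝ/ℤ`. -/
structure IsCenterline (κmax cΓ : ℝ) (X : ℝ → E3) : Prop where
  contDiff : ContDiff ℝ 2 X
  periodic : Function.Periodic X 1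
  arclength : ∀ s, ‖deriv X s‖ = 1
  curvature_le : ∀ s, ‖deriv (deriv X) s‖ ≤ κmax
  non_intersecting : ∀ s t, cΓ * ‖((s - t : ℝ) : UnitAddCircle)‖ ≤ ‖X s - X t‖

/-- `(X', e₁, e₂)` is a periodic `C¹` orthonormal frame along the curve `X`
(for a curve `X` with unit tangent `X'`). -/
structure IsFrame (X e₁ e₂ : ℝ → E3) : Prop where
  contDiff₁ : ContDiff ℝ 1 e₁
  contDiff₂ : ContDiff ℝ 1 e₂
  periodic₁ : Function.Periodic e₁ 1
  periodic₂ : Function.Periodic e₂ 1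
  norm₁ : ∀ s, ‖e₁ s‖ = 1
  norm₂ : ∀ s, ‖e₂ s‖ = 1
  inner₁₂ : ∀ s, inner ℝ (e₁ s) (e₂ s) = 0
  inner_tangent₁ : ∀ s, inner ℝ (deriv X s) (e₁ s) = 0
  inner_tangent₂ : ∀ s, inner ℝ (deriv X s) (e₂ s) = 0

/-- The radial unit vector `e_ρ(s, θ) = cos θ e₁(s) + sin θ e₂(s)`. -/
def eRho (e₁ e₂ : ℝ → E3) (s θ : ℝ) : E3 := Real.cos θ • e₁ s + Real.sin θ • e₂ s

/-- Every point at distance less than `r` from the curve is `X(s) + ρ e_ρ(s, θ)` with `0 ≤ ρ < r`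
for exactly one `s` in `ℝ/ℤ`. (Then `ρ e_ρ(s, θ)`, hence `ρ`, and `θ` modulo `2π` if `ρ ≠ 0`,
are determined too.) -/
def IsTubeRadius (X e₁ e₂ : ℝ → E3) (r : ℝ) : Prop :=
  ∀ x : E3, Metric.infDist x (range X) < r →
    ∃! s : ℝ, s ∈ Ico (0 : ℝ) 1 ∧
      ∃ ρ θ : ℝ, 0 ≤ ρ ∧ ρ < r ∧ x = X s + ρ • eRho e₁ e₂ s θ

/-- The slender body `Σ_ε` of radius `ε`. -/
def body (X e₁ e₂ : ℝ → E3) (ε : ℝ) : Set E3 :=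
  {x | ∃ s ρ θ : ℝ, 0 ≤ ρ ∧ ρ < ε ∧ x = X s + ρ • eRho e₁ e₂ s θ}

/-- The exterior domain `Ω_ε`, the complement of the closure of `Σ_ε`. -/
def exterior (X e₁ e₂ : ℝ → E3) (ε : ℝ) : Set E3 := (closure (body X e₁ e₂ ε))ᶜ

/-- The parametrization `Γ_ε(s, θ) = X(s) + ε e_ρ(s, θ)` of the fiber surface. -/
def surface (X e₁ e₂ : ℝ → E3) (ε : ℝ) (p : ℝ × ℝ) : E3 := X p.1 + ε • eRho e₁ e₂ p.1 p.2

/-- The surface Jacobian `ε (1 - ε (κ₁(s) cos θ + κ₂(s) sin θ))`, where `κⱼ = X'' · eⱼ`. -/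
def surfaceJacobian (X e₁ e₂ : ℝ → E3) (ε : ℝ) (p : ℝ × ℝ) : ℝ :=
  ε * (1 - ε * (inner ℝ (deriv (deriv X) p.1) (e₁ p.1) * Real.cos p.2
    + inner ℝ (deriv (deriv X) p.1) (e₂ p.1) * Real.sin p.2))

/-- The surface measure of the fiber surface in the coordinates `(s, θ) ∈ [0, 1) × [0, 2π)`. -/
def surfaceMeasure (X e₁ e₂ : ℝ → E3) (ε : ℝ) : Measure (ℝ × ℝ) :=
  ((volume : Measure (ℝ × ℝ)).restrict (Ico (0 : ℝ) 1 ×ˢ Ico (0 : ℝ) (2 * Real.pi))).withDensity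
    (fun p => ENNReal.ofReal (surfaceJacobian X e₁ e₂ ε p))

/-- Values of gradients of vector fields on `ℝ³`: the `i`-th entry is the `i`-th partial
derivative, a vector of `ℝ³`, and the norm is the Euclidean (Frobenius) norm of all nine entries. -/
abbrev GradE3 : Type := PiLp 2 (fun _ : Fin 3 => E3)

/-- `G` is the weak gradient of `u` on the open set `Ω`. -/
def IsWeakGradient (Ω : Set E3) (u : E3 → E3) (G : E3 → GradE3) : Prop :=
  ∀ φ : E3 → ℝ, ContDiff ℝ ∞ φ → HasCompactSupport φ → tsupport φ ⊆ Ω → ∀ i : Fin 3,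
    ∫ x in Ω, fderiv ℝ φ x (EuclideanSpace.single i 1) • u x = - ∫ x in Ω, φ x • G x i

/-- `u ∈ D^{1,2}(Ω)`, with weak gradient `G`: `u ∈ L⁶(Ω)` and `∇u = G ∈ L²(Ω)`. -/
structure MemD12 (Ω : Set E3) (u : E3 → E3) (G : E3 → GradE3) : Prop where
  memLp : MemLp u 6 (volume.restrict Ω)
  grad_memLp : MemLp G 2 (volume.restrict Ω)
  weakGradient : IsWeakGradient Ω u G

/-- The classical gradient of a vector field. -/
def classicalGrad (v : E3 → E3) (x : E3) : GradE3 :=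
  WithLp.toLp 2 (fun i : Fin 3 => fderiv ℝ v x (EuclideanSpace.single i 1))

/-- `u ∈ D^{1,2}(Ω_ε)`, with weak gradient `G`, has the trace `g ∈ L²(Γ_ε)` (in the coordinates
`(s, θ)`): the trace operator is the continuous extension of the restriction to the surface
of fields in `C¹(Ω_ε) ∩ C⁰(closure Ω_ε) ∩ D^{1,2}(Ω_ε)`, for the norm `‖∇·‖_{L²}` of `D^{1,2}`. -/
def HasTrace (X e₁ e₂ : ℝ → E3) (ε : ℝ) (u : E3 → E3) (G : E3 → GradE3) (g : ℝ × ℝ → E3) :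
    Prop :=
  MemD12 (exterior X e₁ e₂ ε) u G ∧
  MemLp g 2 (surfaceMeasure X e₁ e₂ ε) ∧
  ∃ v : ℕ → E3 → E3,
    (∀ k, ContDiffOn ℝ 1 (v k) (exterior X e₁ e₂ ε)) ∧
    (∀ k, ContinuousOn (v k) (closure (exterior X e₁ e₂ ε))) ∧
    (∀ k, MemD12 (exterior X e₁ e₂ ε) (v k) (classicalGrad (v k))) ∧
    Tendsto (fun k => eLpNorm (classicalGrad (v k) - G) 2
      (volume.restrict (exterior X e₁ e₂ ε))) atTop (𝓝 0) ∧
    Tendsto (fun k => eLpNorm (fun p => v k (surface X e₁ e₂ ε p) - g p) 2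
      (surfaceMeasure X e₁ e₂ ε)) atTop (𝓝 0)

/-- `u`, with weak gradient `G`, lies in the space `𝒜_ε` of fields of `D^{1,2}(Ω_ε)` with
`θ`-independent trace, and its trace is the function `w` of `s` alone. -/
def MemA (X e₁ e₂ : ℝ → E3) (ε : ℝ) (u : E3 → E3) (G : E3 → GradE3) (w : ℝ → E3) : Prop :=
  ∃ g : ℝ × ℝ → E3, HasTrace X e₁ e₂ ε u G g ∧
    ∀ᵐ p ∂(surfaceMeasure X e₁ e₂ ε), g p = w p.1

end SlenderBody

end

/-! The inequality is the critical case of a Riesz potential estimate: a field is controlled by the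
potential of its gradient with kernel `|x - y|⁻²`, and the square of this operator has kernel
comparable to `|x - x'|⁻¹`, whose integral in `(s, θ)` over a thin tube of radius `η` is of order
`|log η|`.

To bound `v` at a surface point, one integrates `∇v` along rays that never meet the tube. Near the
point a cone of such rays exists because the curve has reach `4 ε` (`IsTubeRadius.hasReach`).
Farther away, other portions of the tube may block rays, and a tube of radius `η` blocks a
proportion of directions of order `η / (cΓ ε)`. This is small when `η = δ ε` with `δ` small in terms
of `cΓ` (`exists_directions`). So the tube of radius `ε` is first shrunk to radius `δ ε` by a
bi-Lipschitz change of variables `Φ` (`IsBlowUp`), and the rays are drawn outside the thinner tube.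
Since `v ∈ L⁶`, almost every ray carries `v` to zero at infinity, and averaging over the free rays
gives `|v(x)| ≤ C ∫ |∇v(Φ y)| |y - x₀|⁻² dy`, where `Φ` takes the point `x₀` of the thin tube to `x`
(`exists_pointwise_bound`).

A Cauchy–Schwarz argument of Schur type (`lintegral_sq_lintegral_mul_le`) reduces the `L²` bound of
this operator to the iterated kernel; `exists_lintegral_inv_sq_mul_inv_sq_le` and
`exists_lintegral_inv_surface_le` bound it by a multiple of `|log ε|`. This proves the inequality
for fields that are `C¹` in the exterior and continuous up to the boundary, and Fatou's lemma along
an approximating sequence passes to `D^{1,2}`. -/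

namespace SlenderBody

/-- `e` is a unit vector normal to the curve `X` at `X s`. -/
def IsUnitNormal (X : ℝ → E3) (s : ℝ) (e : E3) : Prop :=
  ‖e‖ = 1 ∧ inner ℝ (deriv X s) e = 0

/-- The curve `X` has reach at least `R`: no ball of radius `R` tangent to the curve contains
a point of the curve in its interior. -/
def HasReach (X : ℝ → E3) (R : ℝ) : Prop :=
  ∀ s e, IsUnitNormal X s e → ∀ t, 2 * R * inner ℝ e (X t - X s) ≤ ‖X t - X s‖ ^ 2

/-! ### Normals, nearest points, and the reach of the centerline. -/

section Curve

variable {X e₁ e₂ : ℝ → E3} {κmax cΓ : ℝ}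

theorem IsCenterline.differentiable (hX : IsCenterline κmax cΓ X) : Differentiable ℝ X :=
  hX.contDiff.differentiable (by norm_num)

theorem IsCenterline.isCompact_range (hX : IsCenterline κmax cΓ X) : IsCompact (range X) := by
  have h := hX.periodic.image_Icc one_pos 0
  rw [← h]
  exact isCompact_Icc.image hX.differentiable.continuous

theorem IsCenterline.lipschitz (hX : IsCenterline κmax cΓ X) (s t : ℝ) :
    ‖X s - X t‖ ≤ |s - t| := by
  have := Convex.norm_image_sub_le_of_norm_deriv_le (f := X) (C := 1) (s := univ) (x := t) (y := s)
    (fun x _ => hX.differentiable x) (fun x _ => (hX.arclength x).le) convex_univ trivial trivial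
  simpa using this

theorem IsCenterline.exists_nearest (hX : IsCenterline κmax cΓ X) (x : E3) :
    ∃ s, Metric.infDist x (range X) = ‖x - X s‖ := by
  obtain ⟨y, ⟨s, rfl⟩, h⟩ := hX.isCompact_range.exists_infDist_eq_dist (range_nonempty X) x
  exact ⟨s, by rw [h, dist_eq_norm]⟩

theorem IsCenterline.infDist_le (x : E3) (t : ℝ) :
    Metric.infDist x (range X) ≤ ‖x - X t‖ := by
  rw [← dist_eq_norm]
  exact Metric.infDist_le_dist_of_mem (mem_range_self t)

theorem IsFrame.isUnitNormal_eRho (hF : IsFrame X e₁ e₂) (s θ : ℝ) :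
    IsUnitNormal X s (eRho e₁ e₂ s θ) := by
  constructor
  · have h : ‖eRho e₁ e₂ s θ‖ ^ 2 = 1 := by
      rw [eRho, @norm_add_sq ℝ, norm_smul, norm_smul, inner_smul_left, inner_smul_right,
        hF.inner₁₂, hF.norm₁, hF.norm₂]
      simp
    nlinarith [norm_nonneg (eRho e₁ e₂ s θ)]
  · simp [eRho, inner_add_right, inner_smul_right, hF.inner_tangent₁, hF.inner_tangent₂]

/-- Local extrema of both kinds are allowed because the farthest point is needed too, in
`HasReach.one_ge`. -/
theorem inner_deriv_eq_zero_of_isMin (hd : Differentiable ℝ X) {x : E3} {s : ℝ}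
    (h : IsLocalExtr (fun t => ‖x - X t‖ ^ 2) s) : inner ℝ (deriv X s) (x - X s) = 0 := by
  have h1 : HasDerivAt (fun t => x - X t) (-deriv X s) s := (hd s).hasDerivAt.const_sub x
  have h2 := h.hasDerivAt_eq_zero h1.norm_sq
  rw [inner_neg_right, real_inner_comm] at h2
  linarith

/-- Every point is reached from the curve along a normal whose length is the distance
to the curve. -/
theorem IsCenterline.exists_normal_form (hX : IsCenterline κmax cΓ X) (hF : IsFrame X e₁ e₂)
    (x : E3) : ∃ s e, IsUnitNormal X s e ∧ x = X s + Metric.infDist x (range X) • e := by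
  obtain ⟨s, hs⟩ := hX.exists_nearest x
  by_cases h0 : Metric.infDist x (range X) = 0
  · refine ⟨s, e₁ s, ⟨hF.norm₁ s, hF.inner_tangent₁ s⟩, ?_⟩
    rw [h0] at hs ⊢
    rw [zero_smul, add_zero]
    exact sub_eq_zero.1 (norm_eq_zero.1 hs.symm)
  · set d := Metric.infDist x (range X) with hd
    have hmin : IsLocalExtr (fun t => ‖x - X t‖ ^ 2) s := by
      left
      refine Eventually.of_forall fun t => ?_
      have := IsCenterline.infDist_le (X := X) x t
      rw [← hd, hs] at this
      show ‖x - X s‖ ^ 2 ≤ ‖x - X t‖ ^ 2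
      gcongr
    refine ⟨s, d⁻¹ • (x - X s), ⟨?_, ?_⟩, ?_⟩
    · rw [norm_smul, ← hs, norm_inv, Real.norm_of_nonneg Metric.infDist_nonneg]
      exact inv_mul_cancel₀ h0
    · rw [inner_smul_right, inner_deriv_eq_zero_of_isMin hX.differentiable hmin, mul_zero]
    · rw [smul_inv_smul₀ h0]; abel

/-- In the orthonormal basis `(X', e₁, e₂)` a unit normal has no tangential coordinate, so its other
two form a point of the unit circle, and `θ` is its argument. -/
theorem IsFrame.exists_eRho_eq (hX : IsCenterline κmax cΓ X) (hF : IsFrame X e₁ e₂) {s : ℝ} {e : E3}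
    (he : IsUnitNormal X s e) : ∃ θ, e = eRho e₁ e₂ s θ := by
  let b : Fin 3 → E3 := ![deriv X s, e₁ s, e₂ s]
  have hb : Orthonormal ℝ b := by
    rw [orthonormal_iff_ite]
    intro i j
    have h1 := hF.inner₁₂ s
    have h2 := hF.inner_tangent₁ s
    have h3 := hF.inner_tangent₂ s
    fin_cases i <;> fin_cases j <;>
      simp [b, hX.arclength, hF.norm₁, hF.norm₂, h1, h2, h3, real_inner_comm _ (e₁ s),
        real_inner_comm _ (e₂ s)]
  have hspan : ⊤ ≤ Submodule.span ℝ (range b) := by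
    have := hb.linearIndependent.span_eq_top_of_card_eq_finrank' (by simp)
    rw [this]
  let B := OrthonormalBasis.mk hb hspan
  have hsum := B.sum_repr' e
  have hnorm := B.sum_sq_norm_inner_right e
  simp only [B, OrthonormalBasis.coe_mk, Fin.sum_univ_three] at hsum hnorm
  have hb0 : inner ℝ (b 0) e = 0 := he.2
  rw [hb0] at hsum hnorm
  rw [he.1] at hnorm
  set p := inner ℝ (b 1) e
  set q := inner ℝ (b 2) e
  have hpq : ‖(⟨p, q⟩ : ℂ)‖ = 1 := by
    rw [Complex.norm_def, Complex.normSq_mk]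
    simp only [Real.norm_eq_abs, sq_abs] at hnorm
    rw [show p * p + q * q = 1 by nlinarith]; simp
  have h0 : (⟨p, q⟩ : ℂ) ≠ 0 := by intro h; simp [h] at hpq
  refine ⟨Complex.arg ⟨p, q⟩, ?_⟩
  rw [eRho, Complex.cos_arg h0, Complex.sin_arg, hpq, ← hsum]
  simp [b]

theorem eRho_fract (hF : IsFrame X e₁ e₂) (s θ : ℝ) :
    eRho e₁ e₂ (Int.fract s) θ = eRho e₁ e₂ s θ := by
  have h1 := hF.periodic₁.sub_zsmul_eq (x := s) ⌊s⌋
  have h2 := hF.periodic₂.sub_zsmul_eq (x := s) ⌊s⌋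
  simp only [zsmul_eq_mul, mul_one, Int.self_sub_floor] at h1 h2
  rw [eRho, h1, h2, eRho]

theorem IsCenterline.apply_fract (hX : IsCenterline κmax cΓ X) (s : ℝ) :
    X (Int.fract s) = X s := by
  have h1 := hX.periodic.sub_zsmul_eq (x := s) ⌊s⌋
  simpa only [zsmul_eq_mul, mul_one, Int.self_sub_floor] using h1

/-- The center `X s + R e` of a tangent ball also has a representation along the normal at a nearest
point of the curve. Uniqueness in the tube identifies the two feet, so `R` is the distance from the
center to the curve, and the open ball contains no point of it. -/
theorem IsTubeRadius.hasReach (hX : IsCenterline κmax cΓ X) (hF : IsFrame X e₁ e₂) {r R : ℝ}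
    (hr : IsTubeRadius X e₁ e₂ r) (hR : 0 < R) (hRr : R < r) : HasReach X R := by
  intro s e he t
  have hle : Metric.infDist (X s + R • e) (range X) ≤ R := by
    refine (IsCenterline.infDist_le (X := X) (X s + R • e) s).trans ?_
    rw [add_sub_cancel_left, norm_smul, he.1, Real.norm_of_nonneg hR.le, mul_one]
  obtain ⟨s', e', he', hx⟩ := hX.exists_normal_form hF (X s + R • e)
  set d := Metric.infDist (X s + R • e) (range X) with hd
  obtain ⟨θ, rfl⟩ := IsFrame.exists_eRho_eq hX hF he
  obtain ⟨θ', rfl⟩ := IsFrame.exists_eRho_eq hX hF he'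
  obtain ⟨s₀, -, huniq⟩ := hr _ (hle.trans_lt hRr)
  have h1 := huniq (Int.fract s) ⟨⟨Int.fract_nonneg s, Int.fract_lt_one s⟩, R, θ, hR.le, hRr, by
    rw [eRho_fract hF, hX.apply_fract]⟩
  have h2 := huniq (Int.fract s') ⟨⟨Int.fract_nonneg s', Int.fract_lt_one s'⟩, d, θ',
    Metric.infDist_nonneg, hle.trans_lt hRr, by rw [eRho_fract hF, hX.apply_fract, ← hx]⟩
  have hss : X s = X s' := by rw [← hX.apply_fract s, ← hX.apply_fract s', h1, h2]
  have hRd : R = d := by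
    have := congrArg norm (add_left_cancel (hx.trans (by rw [← hss])))
    rwa [norm_smul, norm_smul, he.1, he'.1, Real.norm_of_nonneg hR.le, mul_one, mul_one,
      Real.norm_of_nonneg Metric.infDist_nonneg] at this
  have hle2 := IsCenterline.infDist_le (X := X) (X s + R • eRho e₁ e₂ s θ) t
  rw [← hd, ← hRd] at hle2
  have hsq : R ^ 2 ≤ ‖X s + R • eRho e₁ e₂ s θ - X t‖ ^ 2 := by gcongr
  rw [show X s + R • eRho e₁ e₂ s θ - X t = R • eRho e₁ e₂ s θ - (X t - X s) by abel,
    @norm_sub_sq ℝ, norm_smul, he.1, Real.norm_of_nonneg hR.le, inner_smul_left] at hsq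
  simp only [conj_trivial, RCLike.re_to_real] at hsq
  linarith

/-- The chord from `X 0` to the farthest point of the curve is normal there. The tangent ball in
this direction gives `2 R` at most the chord length, which is at most `1` by arclength. With `R = 4
ε` this yields `ε ≤ 1/8`, which keeps `|log ε|` away from zero. -/
theorem HasReach.one_ge (hX : IsCenterline κmax cΓ X) (hcΓ : 0 < cΓ) {R : ℝ}
    (h : HasReach X R) : 2 * R ≤ 1 := by
  obtain ⟨y, ⟨t', rfl⟩, ht'⟩ := hX.isCompact_range.exists_isMaxOn (range_nonempty X)
    (f := fun y => ‖X 0 - y‖ ^ 2) (by fun_prop)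
  have hmax : ∀ t, ‖X 0 - X t‖ ^ 2 ≤ ‖X 0 - X t'‖ ^ 2 := fun t => ht' (mem_range_self t)
  have hperp := inner_deriv_eq_zero_of_isMin (X := X) (x := X 0) (s := t') hX.differentiable
    (Or.inr (Eventually.of_forall hmax))
  have hpos : 0 < ‖X 0 - X t'‖ := by
    have h1 := hmax (1 / 2)
    have h2 := hX.non_intersecting 0 (1 / 2)
    have h3 : 0 < ‖((0 - 1 / 2 : ℝ) : UnitAddCircle)‖ := by
      rw [UnitAddCircle.norm_eq]
      have : round (0 - 1 / 2 : ℝ) = 0 := by norm_num [round_eq]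
      rw [this]; norm_num
    have h4 : 0 < ‖X 0 - X (1 / 2)‖ := lt_of_lt_of_le (by positivity) h2
    have h5 : 0 < ‖X 0 - X t'‖ ^ 2 := lt_of_lt_of_le (by positivity) h1
    by_contra! h6
    rw [le_antisymm h6 (norm_nonneg _)] at h5; norm_num at h5
  have hn : IsUnitNormal X t' (‖X 0 - X t'‖⁻¹ • (X 0 - X t')) := by
    refine ⟨?_, ?_⟩
    · rw [norm_smul, norm_inv, norm_norm, inv_mul_cancel₀ hpos.ne']
    · rw [inner_smul_right, hperp, mul_zero]
  have h1 := h t' _ hn 0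
  rw [inner_smul_left, real_inner_self_eq_norm_sq] at h1
  simp only [conj_trivial] at h1
  have h2 : ‖X 0 - X t'‖ ≤ 1 := by
    rw [← hX.apply_fract t']
    refine (hX.lipschitz _ _).trans ?_
    rw [zero_sub, abs_neg, abs_of_nonneg (Int.fract_nonneg _)]
    exact (Int.fract_lt_one _).le
  have h3 : 2 * R * ‖X 0 - X t'‖ ≤ ‖X 0 - X t'‖ * ‖X 0 - X t'‖ := by
    calc _ = 2 * R * (‖X 0 - X t'‖⁻¹ * ‖X 0 - X t'‖ ^ 2) := by field_simp
      _ ≤ _ := by rw [← sq]; exact h1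
  exact (le_of_mul_le_mul_right h3 hpos).trans h2

/-- The defect `f` in the reach inequality is nonnegative, vanishes at `s`, and has `f''(s) = 2 - 2
R ⟨X'', e⟩`. Were this negative, `s` would be a local maximum, so `f` would vanish near `s` and
`f''(s)` would be zero. -/
theorem HasReach.mul_inner_le (hX : IsCenterline κmax cΓ X) {R : ℝ} (h : HasReach X R)
    {s : ℝ} {e : E3} (he : IsUnitNormal X s e) : R * inner ℝ (deriv (deriv X) s) e ≤ 1 := by
  by_contra! hlt
  let f : ℝ → ℝ := fun t => ‖X t - X s‖ ^ 2 - 2 * R * inner ℝ e (X t - X s)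
  have hdX : Differentiable ℝ (deriv X) :=
    (contDiff_succ_iff_deriv.1 (by simpa [one_add_one_eq_two] using hX.contDiff :
      ContDiff ℝ (1 + 1) X)).2.2.differentiable
      (by norm_num)
  have hf : ∀ t, HasDerivAt f (2 * inner ℝ (X t - X s) (deriv X t)
      - 2 * R * inner ℝ e (deriv X t)) t := by
    intro t
    have h1 : HasDerivAt (fun t => X t - X s) (deriv X t) t :=
      (hX.differentiable t).hasDerivAt.sub_const _
    have h2 := (hasDerivAt_const t e).inner ℝ h1
    simp only [inner_zero_left, add_zero] at h2
    exact h1.norm_sq.sub (h2.const_mul _)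
  have hf' : deriv f = fun t => 2 * inner ℝ (X t - X s) (deriv X t)
      - 2 * R * inner ℝ e (deriv X t) := funext fun t => (hf t).deriv
  have hs0 : deriv f s = 0 := by
    rw [hf']; simp [real_inner_comm _ e, he.2]
  have hf2 : deriv (deriv f) s < 0 := by
    rw [hf']
    have h1 : HasDerivAt (fun t => X t - X s) (deriv X s) s :=
      (hX.differentiable s).hasDerivAt.sub_const _
    have h3 := (h1.inner ℝ (hdX s).hasDerivAt).const_mul 2
    have h2 := ((hasDerivAt_const s e).inner ℝ (hdX s).hasDerivAt).const_mul (2 * R)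
    rw [(h3.fun_sub h2).deriv, real_inner_self_eq_norm_sq, hX.arclength,
      real_inner_comm (deriv (deriv X) s) e]
    simp
    linarith
  have hmax := isLocalMax_of_deriv_deriv_neg hf2 hs0 (hf s).continuousAt
  have hconst : f =ᶠ[𝓝 s] fun _ => 0 := by
    filter_upwards [hmax] with t ht
    have h1 := h s e he t
    have h2 : f s = 0 := by simp [f]
    rw [h2] at ht
    refine le_antisymm ht ?_
    simp only [f]; linarith
  have : deriv (deriv f) s = 0 := by
    rw [hconst.deriv.deriv_eq]; simp
  linarith

end Curve

/-! ### Normal coordinates in the tube and the blow-up map. -/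

section Reach

variable {X e₁ e₂ : ℝ → E3} {κmax cΓ : ℝ}

/-- The two reach inequalities, at `s` and at `t`, are added with weights `ρ` and `σ`. For `ρ + σ <
2 R` this makes the nearest-point projection Lipschitz. -/
theorem HasReach.inner_sub_ge {R : ℝ} (h : HasReach X R) {s t : ℝ} {e e' : E3}
    (he : IsUnitNormal X s e) (he' : IsUnitNormal X t e') {ρ σ : ℝ} (hρ : 0 ≤ ρ) (hσ : 0 ≤ σ) :
    (2 * R - (ρ + σ)) * ‖X s - X t‖ ^ 2 ≤
      2 * R * inner ℝ (X s + ρ • e - (X t + σ • e')) (X s - X t) := by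
  have h1 := h s e he t
  have h2 := h t e' he' s
  have h3 : inner ℝ e (X t - X s) = - inner ℝ e (X s - X t) := by
    rw [← neg_sub (X s), inner_neg_right]
  rw [h3, norm_sub_rev] at h1
  rw [show X s + ρ • e - (X t + σ • e') = (X s - X t) + ρ • e - σ • e' by abel, inner_sub_left,
    inner_add_left, inner_smul_left, inner_smul_left, real_inner_self_eq_norm_sq]
  simp only [conj_trivial]
  nlinarith [mul_le_mul_of_nonneg_left h1 hρ, mul_le_mul_of_nonneg_left h2 hσ]

theorem HasReach.infDist_eq {R : ℝ} (h : HasReach X R) {s : ℝ} {e : E3}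
    (he : IsUnitNormal X s e) {ρ : ℝ} (hρ : 0 ≤ ρ) (hρR : ρ ≤ R) :
    Metric.infDist (X s + ρ • e) (range X) = ρ := by
  refine le_antisymm ((IsCenterline.infDist_le _ s).trans ?_) ?_
  · rw [add_sub_cancel_left, norm_smul, he.1, Real.norm_of_nonneg hρ, mul_one]
  · refine (Metric.le_infDist (range_nonempty X)).2 ?_
    rintro _ ⟨t, rfl⟩
    rw [dist_eq_norm]
    refine le_of_sq_le_sq ?_ (norm_nonneg _)
    have h1 := h s e he t
    rw [show X s + ρ • e - X t = ρ • e - (X t - X s) by abel,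
      @norm_sub_sq ℝ, norm_smul, he.1, Real.norm_of_nonneg hρ, inner_smul_left]
    simp only [conj_trivial, RCLike.re_to_real]
    by_cases h2 : inner ℝ e (X t - X s) ≤ 0
    · nlinarith [mul_nonneg hρ (neg_nonneg.2 h2), sq_nonneg ‖X t - X s‖]
    · nlinarith [mul_nonneg (sub_nonneg.2 hρR) (not_le.1 h2).le]

theorem abs_infDist_sub_le (x y : E3) :
    |Metric.infDist x (range X) - Metric.infDist y (range X)| ≤ ‖x - y‖ := by
  have := (Metric.lipschitz_infDist_pt (range X)).dist_le_mul x y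
  simpa [Real.dist_eq, dist_eq_norm] using this

/-- Foot point, radius and normal depend on the point in a Lipschitz way. With `R = 4 ε` and radii
at most `3 ε`, the factor `2 R - (ρ + σ)` is at least `2 ε`, whence the constant `4`; the radius is
a distance function; and `6 = 1 + 4 + 1` is the triangle inequality for `ρ (e - e')`. -/
theorem HasReach.normal_comparison {ε : ℝ} (hε : 0 < ε) (h : HasReach X (4 * ε)) {s t : ℝ}
    {e e' : E3} (he : IsUnitNormal X s e) (he' : IsUnitNormal X t e') {ρ σ : ℝ}
    (hρ : 0 ≤ ρ) (hσ : 0 ≤ σ) (hρ' : ρ ≤ 3 * ε) (hσ' : σ ≤ 3 * ε) :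
    ‖X s - X t‖ ≤ 4 * ‖X s + ρ • e - (X t + σ • e')‖ ∧
    |ρ - σ| ≤ ‖X s + ρ • e - (X t + σ • e')‖ ∧
    ρ * ‖e - e'‖ ≤ 6 * ‖X s + ρ • e - (X t + σ • e')‖ := by
  have hD : ‖X s - X t‖ ≤ 4 * ‖X s + ρ • e - (X t + σ • e')‖ := by
    have h1 := h.inner_sub_ge he he' hρ hσ
    have h2 := real_inner_le_norm (X s + ρ • e - (X t + σ • e')) (X s - X t)
    rcases (norm_nonneg (X s - X t)).eq_or_lt with h0 | h0
    · rw [← h0]; positivity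
    · refine le_of_mul_le_mul_right ?_ (mul_pos hε h0)
      nlinarith [mul_nonneg (show 0 ≤ 6 * ε - (ρ + σ) by linarith) (sq_nonneg ‖X s - X t‖),
        mul_le_mul_of_nonneg_left h2 hε.le]
  have hρσ : |ρ - σ| ≤ ‖X s + ρ • e - (X t + σ • e')‖ := by
    have := abs_infDist_sub_le (X := X) (X s + ρ • e) (X t + σ • e')
    rwa [h.infDist_eq he hρ (by linarith), h.infDist_eq he' hσ (by linarith)] at this
  refine ⟨hD, hρσ, ?_⟩
  calc ρ * ‖e - e'‖ = ‖ρ • (e - e')‖ := by rw [norm_smul, Real.norm_of_nonneg hρ]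
    _ = ‖(X s + ρ • e - (X t + σ • e')) - (X s - X t) - (ρ - σ) • e'‖ := by
      congr 1; module
    _ ≤ ‖X s + ρ • e - (X t + σ • e')‖ + ‖X s - X t‖ + |ρ - σ| := by
      refine (norm_sub_le _ _).trans (add_le_add (norm_sub_le _ _) ?_)
      rw [norm_smul, he'.1, mul_one, Real.norm_eq_abs]
    _ ≤ _ := by linarith

theorem norm_normal_sub_le {s t : ℝ} {e e' : E3} (he' : IsUnitNormal X t e') {ρ : ℝ} (hρ : 0 ≤ ρ)
    (σ : ℝ) :
    ‖X s + ρ • e - (X t + σ • e')‖ ≤ ‖X s - X t‖ + |ρ - σ| + ρ * ‖e - e'‖ := by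
  calc ‖X s + ρ • e - (X t + σ • e')‖ = ‖(X s - X t) + (ρ - σ) • e' + ρ • (e - e')‖ := by
        congr 1; module
    _ ≤ _ := by
      refine (norm_add_le _ _).trans (add_le_add ((norm_add_le _ _).trans ?_) ?_)
      · rw [norm_smul, he'.1, mul_one, Real.norm_eq_abs]
      · rw [norm_smul, Real.norm_of_nonneg hρ]

/-- When the square is expanded, the cross term can be negative, but the reach bounds its loss by
half of `‖X s - X t‖²`. -/
theorem HasReach.sq_norm_sub_ge {ε η : ℝ} (h : HasReach X (4 * ε)) (hη : 0 < η) (hηε : η ≤ ε)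
    {s t : ℝ} {e e' : E3} (he : IsUnitNormal X s e) (he' : IsUnitNormal X t e') :
    ‖X s - X t‖ ^ 2 / 2 + η ^ 2 * ‖e - e'‖ ^ 2 ≤ ‖X s + η • e - (X t + η • e')‖ ^ 2 := by
  have h1 := h s e he t
  have h2 := h t e' he' s
  have h3 : inner ℝ e (X t - X s) = - inner ℝ (X s - X t) e := by
    rw [← neg_sub (X s), inner_neg_right, real_inner_comm]
  rw [h3, norm_sub_rev] at h1
  rw [real_inner_comm] at h2
  rw [show X s + η • e - (X t + η • e') = (X s - X t) + η • (e - e') by module,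
    @norm_add_sq ℝ, norm_smul, Real.norm_of_nonneg hη.le, inner_smul_right, inner_sub_right]
  simp only [RCLike.re_to_real]
  have h4 : -(inner ℝ (X s - X t) e - inner ℝ (X s - X t) e') * (8 * ε) ≤
      2 * ‖X s - X t‖ ^ 2 := by linarith
  have hε : 0 < ε := hη.trans_le hηε
  have h5 : -(inner ℝ (X s - X t) e - inner ℝ (X s - X t) e') ≤ ‖X s - X t‖ ^ 2 / (4 * ε) := by
    rw [le_div_iff₀ (by positivity)]; linarith
  have h6 : η * (‖X s - X t‖ ^ 2 / (4 * ε)) ≤ ‖X s - X t‖ ^ 2 / 4 := by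
    rw [← mul_div_assoc, div_le_div_iff₀ (by positivity) (by positivity)]
    nlinarith [sq_nonneg ‖X s - X t‖]
  nlinarith [mul_le_mul_of_nonneg_left h5 hη.le]

/-- The radial profile of the blow-up of a tube of radius `η` to a tube of radius `ε`. -/
noncomputable def stretch (ε η ρ : ℝ) : ℝ := max ρ (ε + (ρ - η) / 2)

theorem abs_stretch_sub_le (ε η ρ σ : ℝ) : |stretch ε η ρ - stretch ε η σ| ≤ |ρ - σ| := by
  refine (abs_max_sub_max_le_max _ _ _ _).trans (max_le le_rfl ?_)
  rw [show ε + (ρ - η) / 2 - (ε + (σ - η) / 2) = (ρ - σ) / 2 by ring, abs_div]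
  norm_num

/-- Both branches of `stretch` have slope at least `1/2`. -/
theorem abs_sub_le_stretch (ε η ρ σ : ℝ) : |ρ - σ| ≤ 2 * |stretch ε η ρ - stretch ε η σ| := by
  wlog hle : σ ≤ ρ generalizing ρ σ
  · rw [abs_sub_comm, abs_sub_comm (stretch ε η ρ)]
    exact this _ _ (le_of_not_ge hle)
  have h1 : stretch ε η σ + (ρ - σ) / 2 ≤ stretch ε η ρ := by
    unfold stretch
    rw [max_add]
    refine max_le_max (by linarith) (by linarith)
  rw [abs_of_nonneg (by linarith : 0 ≤ ρ - σ), abs_of_nonneg (by linarith)]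
  linarith

/-- `Φ` moves every point along a shortest normal to the curve, so that the exterior of the tube of
radius `η` is mapped to the exterior of the tube of radius `ε`. -/
def IsBlowUp (X : ℝ → E3) (ε η : ℝ) (Φ : E3 → E3) : Prop :=
  ∀ x, ∃ s e, IsUnitNormal X s e ∧ x = X s + Metric.infDist x (range X) • e ∧
    Φ x = X s + stretch ε η (Metric.infDist x (range X)) • e

/-- The nearest point is picked arbitrarily for each `x`. This is harmless: within `3 ε` of the
curve the normal form is unique for `ρ > 0`, and from distance `2 ε` on the map is the identity. -/
theorem IsCenterline.exists_isBlowUp (hX : IsCenterline κmax cΓ X) (hF : IsFrame X e₁ e₂)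
    (ε η : ℝ) : ∃ Φ, IsBlowUp X ε η Φ := by
  choose s e he hx using hX.exists_normal_form hF
  exact ⟨fun x => X (s x) + stretch ε η (Metric.infDist x (range X)) • e x, fun x =>
    ⟨s x, e x, he x, hx x, rfl⟩⟩

variable {ε η : ℝ} {Φ : E3 → E3}

theorem IsBlowUp.eq_self (hΦ : IsBlowUp X ε η Φ) (hη : 0 ≤ η) {x : E3}
    (hx : 2 * ε ≤ Metric.infDist x (range X)) : Φ x = x := by
  obtain ⟨s, e, he, h1, h2⟩ := hΦ x
  -- The branches of `stretch` cross at `ρ = 2 ε - η`, so the first one is active here.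
  rw [h2, stretch, max_eq_left (by linarith), ← h1]

theorem stretch_le {ρ : ℝ} (hη : 0 ≤ η) (hε : 0 ≤ ε) (hρ : ρ ≤ 3 * ε) : stretch ε η ρ ≤ 3 * ε :=
  max_le hρ (by linarith)

theorem IsBlowUp.infDist_eq (hΦ : IsBlowUp X ε η Φ) (h : HasReach X (4 * ε)) (hη : 0 < η)
    (hηε : η ≤ ε) (x : E3) :
    Metric.infDist (Φ x) (range X) = stretch ε η (Metric.infDist x (range X)) := by
  obtain ⟨s, e, he, h1, h2⟩ := hΦ x
  by_cases hx : Metric.infDist x (range X) ≤ 3 * ε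
  · rw [h2, h.infDist_eq he (ρ := stretch ε η _) (le_max_of_le_left Metric.infDist_nonneg)
      ((stretch_le hη.le (by linarith) hx).trans (by linarith))]
  · rw [hΦ.eq_self hη.le (by linarith), stretch, max_eq_left (by linarith)]

theorem IsBlowUp.infDist_gt (hΦ : IsBlowUp X ε η Φ) (h : HasReach X (4 * ε)) (hη : 0 < η)
    (hηε : η ≤ ε) {x : E3} (hx : η < Metric.infDist x (range X)) :
    ε < Metric.infDist (Φ x) (range X) := by
  rw [hΦ.infDist_eq h hη hηε]
  exact lt_max_of_lt_right (by linarith)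

/-- At radius at least `η` the normal varies at rate at most `6 / η`, and the stretched radius is at
most `3 ε`; this is the term `18 ε / η`. Foot point and radius contribute `4 + 1`. -/
theorem IsBlowUp.lipschitz (hΦ : IsBlowUp X ε η Φ) (h : HasReach X (4 * ε)) (hη : 0 < η)
    (hηε : η ≤ ε) {x y : E3} (hx : η ≤ Metric.infDist x (range X))
    (hx' : Metric.infDist x (range X) ≤ 3 * ε) (hy' : Metric.infDist y (range X) ≤ 3 * ε) :
    ‖Φ x - Φ y‖ ≤ (5 + 18 * (ε / η)) * ‖x - y‖ := by
  obtain ⟨s, e, he, h1, h2⟩ := hΦ x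
  obtain ⟨t, e', he', h3, h4⟩ := hΦ y
  have hε : 0 < ε := hη.trans_le hηε
  set ρ := Metric.infDist x (range X)
  set σ := Metric.infDist y (range X)
  obtain ⟨ha, hb, hc⟩ := h.normal_comparison hε he he' (hη.le.trans hx) Metric.infDist_nonneg hx' hy'
  rw [← h1, ← h3] at ha hb hc
  have hd : ‖e - e'‖ ≤ 6 * ‖x - y‖ / η := by
    rw [le_div_iff₀ hη]; nlinarith [norm_nonneg (e - e')]
  have hρ0 : 0 ≤ stretch ε η ρ := (hη.le.trans hx).trans (le_max_left _ _)
  rw [h2, h4]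
  refine (norm_normal_sub_le he' hρ0 _).trans ?_
  have h5 := (abs_stretch_sub_le ε η ρ σ).trans hb
  have h6 := mul_le_mul (stretch_le hη.le hε.le hx') hd (norm_nonneg _) (by linarith)
  calc _ ≤ 4 * ‖x - y‖ + ‖x - y‖ + 3 * ε * (6 * ‖x - y‖ / η) := by linarith
    _ = _ := by ring

/-- The constant does not involve `ε / η`: the images have radius at least `ε`, so their normals
differ by at most `6 / ε` times the distance, which is multiplied by `ρ ≤ 3 ε`. Thus `24 = 4 + 2 +
18`. -/
theorem IsBlowUp.antilipschitz (hΦ : IsBlowUp X ε η Φ) (h : HasReach X (4 * ε)) (hη : 0 < η)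
    (hηε : η ≤ ε) {x y : E3} (hx : η ≤ Metric.infDist x (range X))
    (hx' : Metric.infDist x (range X) ≤ 3 * ε) (hy' : Metric.infDist y (range X) ≤ 3 * ε) :
    ‖x - y‖ ≤ 24 * ‖Φ x - Φ y‖ := by
  obtain ⟨s, e, he, h1, h2⟩ := hΦ x
  obtain ⟨t, e', he', h3, h4⟩ := hΦ y
  have hε : 0 < ε := hη.trans_le hηε
  set ρ := Metric.infDist x (range X)
  set σ := Metric.infDist y (range X)
  have hρσ := abs_sub_le_stretch ε η ρ σ
  have hgρ : ρ ≤ stretch ε η ρ := le_max_left _ _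
  have hgε : ε ≤ stretch ε η ρ := le_max_of_le_right (by linarith)
  obtain ⟨ha, hb, hc⟩ := h.normal_comparison hε he he' (ρ := stretch ε η ρ) (σ := stretch ε η σ)
    (by linarith) (le_max_of_le_left Metric.infDist_nonneg) (stretch_le hη.le hε.le hx')
    (stretch_le hη.le hε.le hy')
  rw [← h2, ← h4] at ha hb hc
  have hd := norm_normal_sub_le (X := X) (s := s) (e := e) he' (hη.le.trans hx) σ
  rw [← h1, ← h3] at hd
  nlinarith [mul_le_mul_of_nonneg_right hx' (norm_nonneg (e - e')),
    mul_le_mul_of_nonneg_right hgε (norm_nonneg (e - e'))]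

theorem IsBlowUp.apply_surface (hΦ : IsBlowUp X ε η Φ) (h : HasReach X (4 * ε)) (hη : 0 < η)
    (hηε : η ≤ ε) {s : ℝ} {e : E3} (he : IsUnitNormal X s e) :
    Φ (X s + η • e) = X s + ε • e := by
  obtain ⟨t, e', he', h1, h2⟩ := hΦ (X s + η • e)
  rw [h.infDist_eq he hη.le (by linarith)] at h1 h2
  obtain ⟨ha, hb, hc⟩ := h.normal_comparison (hη.trans_le hηε) he he' hη.le hη.le (by linarith)
    (by linarith)
  rw [← h1, sub_self, norm_zero, mul_zero] at ha hc
  have hs : X s = X t := sub_eq_zero.1 (norm_le_zero_iff.1 ha)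
  have hee : e = e' := sub_eq_zero.1 (norm_le_zero_iff.1 (by nlinarith [norm_nonneg (e - e')]))
  rw [h2, stretch, max_eq_right (by linarith), sub_self, zero_div, add_zero, hs, hee]

theorem IsBlowUp.eventually_lipschitz (hΦ : IsBlowUp X ε η Φ) (h : HasReach X (4 * ε)) (hη : 0 < η)
    (hηε : η ≤ ε) {x : E3} (hx : η ≤ Metric.infDist x (range X)) :
    ∀ᶠ y in 𝓝 x, ‖Φ y - Φ x‖ ≤ (5 + 18 * (ε / η)) * ‖y - x‖ := by
  have hc : Continuous fun y => Metric.infDist y (range X) := Metric.continuous_infDist_pt _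
  have hε : 0 < ε := hη.trans_le hηε
  by_cases hx' : Metric.infDist x (range X) < 3 * ε
  · filter_upwards [hc.continuousAt.eventually_lt continuousAt_const hx'] with y hy
    rw [norm_sub_rev, norm_sub_rev y]
    exact hΦ.lipschitz h hη hηε hx hx'.le hy.le
  · have hx2 : 2 * ε < Metric.infDist x (range X) := by linarith
    filter_upwards [continuousAt_const.eventually_lt hc.continuousAt hx2] with y hy
    rw [hΦ.eq_self hη.le hy.le, hΦ.eq_self hη.le hx2.le]
    have : 0 < ε / η := by positivity
    nlinarith [norm_nonneg (y - x)]

theorem continuousAt_of_eventually_norm_sub_le {E F : Type*} [SeminormedAddCommGroup E]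
    [SeminormedAddCommGroup F] {f : E → F} {x : E} {C : ℝ}
    (h : ∀ᶠ y in 𝓝 x, ‖f y - f x‖ ≤ C * ‖y - x‖) : ContinuousAt f x := by
  rw [ContinuousAt, tendsto_iff_norm_sub_tendsto_zero]
  refine squeeze_zero' (Eventually.of_forall fun _ => norm_nonneg _) h ?_
  have : ContinuousAt (fun y : E => C * ‖y - x‖) x := by fun_prop
  simpa [ContinuousAt] using this

theorem IsBlowUp.continuousAt (hΦ : IsBlowUp X ε η Φ) (h : HasReach X (4 * ε)) (hη : 0 < η)
    (hηε : η ≤ ε) {x : E3} (hx : η ≤ Metric.infDist x (range X)) : ContinuousAt Φ x :=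
  continuousAt_of_eventually_norm_sub_le (hΦ.eventually_lipschitz h hη hηε hx)

end Reach

/-! ### Integration along rays. -/

section Scaling

theorem lintegral_comp_smul_E3 {f : E3 → ℝ≥0∞} (hf : Measurable f) {r : ℝ} (hr : 0 < r) :
    ∫⁻ y, f (r • y) = ENNReal.ofReal ((r ^ 3)⁻¹) * ∫⁻ y, f y := by
  have h := Measure.map_addHaar_smul (volume : Measure E3) hr.ne'
  rw [finrank_euclideanSpace_fin, abs_of_pos (by positivity)] at h
  rw [← smul_eq_mul, ← lintegral_smul_measure, ← h, lintegral_map hf (by fun_prop)]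

/-- Integration along rays with the weight `λ²` is bounded by integration over space. -/
theorem lintegral_rays_le {F : E3 → ℝ≥0∞} (hF : Measurable F) (x : E3) :
    ∫⁻ w in {w : E3 | 1 ≤ ‖w‖ ∧ ‖w‖ ≤ 2}, ∫⁻ l in Ioi (0 : ℝ),
      ENNReal.ofReal (l ^ 2) * F (x + l • w) ≤ ∫⁻ y, F y := by
  set A : Set E3 := {w : E3 | 1 ≤ ‖w‖ ∧ ‖w‖ ≤ 2} with hA
  have hAm : MeasurableSet A := by
    apply MeasurableSet.inter
    · exact measurableSet_le measurable_const measurable_norm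
    · exact measurableSet_le measurable_norm measurable_const
  have hm1 : Measurable fun p : E3 × ℝ => ENNReal.ofReal (p.2 ^ 2) * F (x + p.2 • p.1) := by
    fun_prop
  rw [lintegral_lintegral_swap hm1.aemeasurable]
  -- With `z = l w` the weight `l² dw` becomes `l⁻¹ dz`, and `w` lies in the shell exactly when `‖z‖
  -- / 2 ≤ l ≤ ‖z‖`. The integral of `l⁻¹` over that interval is at most `1`.
  have h1 : ∀ l ∈ Ioi (0 : ℝ), ∫⁻ w in A, ENNReal.ofReal (l ^ 2) * F (x + l • w) =
      ∫⁻ z, (Icc (‖z‖ / 2) ‖z‖).indicator (fun l => ENNReal.ofReal l⁻¹) l * F (x + z) := by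
    intro l hl
    have hl : 0 < l := hl
    have hmz : Measurable fun z : E3 =>
        {z : E3 | ‖z‖ / 2 ≤ l ∧ l ≤ ‖z‖}.indicator (fun z => ENNReal.ofReal (l ^ 2) * F (x + z)) z := by
      refine Measurable.indicator (by fun_prop) ?_
      exact (measurableSet_le (f := fun z : E3 => ‖z‖ / 2) (by fun_prop) measurable_const).inter
        (measurableSet_le measurable_const measurable_norm)
    have h2 := lintegral_comp_smul_E3 hmz hl
    rw [← lintegral_indicator hAm]
    have e1 : ∀ w, A.indicator (fun w => ENNReal.ofReal (l ^ 2) * F (x + l • w)) w =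
        {z : E3 | ‖z‖ / 2 ≤ l ∧ l ≤ ‖z‖}.indicator
          (fun z => ENNReal.ofReal (l ^ 2) * F (x + z)) (l • w) := by
      intro w
      simp only [indicator, hA, mem_ofPred_eq, norm_smul, Real.norm_of_nonneg hl.le]
      congr 1
      refine propext ⟨fun h => ⟨?_, ?_⟩, fun h => ⟨?_, ?_⟩⟩ <;> nlinarith [h.1, h.2]
    simp_rw [e1]
    rw [h2, ← lintegral_const_mul _ hmz]
    refine lintegral_congr fun z => ?_
    simp only [indicator, mem_ofPred_eq, mem_Icc]
    split_ifs
    · rw [← mul_assoc, ← ENNReal.ofReal_mul (by positivity)]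
      congr 2
      field_simp
    · simp
  rw [setLIntegral_congr_fun measurableSet_Ioi h1]
  have hm2 : Measurable fun p : ℝ × E3 =>
      (Icc (‖p.2‖ / 2) ‖p.2‖).indicator (fun l => ENNReal.ofReal l⁻¹) p.1 * F (x + p.2) := by
    refine Measurable.mul ?_ (by fun_prop)
    have : (fun p : ℝ × E3 => (Icc (‖p.2‖ / 2) ‖p.2‖).indicator (fun l => ENNReal.ofReal l⁻¹) p.1) =
        {p : ℝ × E3 | ‖p.2‖ / 2 ≤ p.1 ∧ p.1 ≤ ‖p.2‖}.indicator
          (fun p => ENNReal.ofReal p.1⁻¹) := by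
      ext p; simp [indicator]
    rw [this]
    refine Measurable.indicator (by fun_prop) ?_
    exact (measurableSet_le (by fun_prop) measurable_fst).inter
        (measurableSet_le measurable_fst (by fun_prop))
  rw [lintegral_lintegral_swap hm2.aemeasurable]
  have h3 : ∀ z : E3, z ≠ 0 → ∫⁻ l in Ioi (0 : ℝ),
      (Icc (‖z‖ / 2) ‖z‖).indicator (fun l => ENNReal.ofReal l⁻¹) l * F (x + z) ≤ F (x + z) := by
    intro z hz
    have hz : 0 < ‖z‖ := norm_pos_iff.2 hz
    rw [lintegral_mul_const _ (by refine Measurable.indicator (by fun_prop) measurableSet_Icc)]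
    refine mul_le_of_le_one_left zero_le ?_
    calc _ ≤ ∫⁻ l : ℝ, (Icc (‖z‖ / 2) ‖z‖).indicator (fun l => ENNReal.ofReal l⁻¹) l :=
          setLIntegral_le_lintegral _ _
      _ = ∫⁻ l in Icc (‖z‖ / 2) ‖z‖, ENNReal.ofReal l⁻¹ := lintegral_indicator measurableSet_Icc _
      _ ≤ ∫⁻ _ in Icc (‖z‖ / 2) ‖z‖, ENNReal.ofReal (‖z‖ / 2)⁻¹ := by
          refine setLIntegral_mono (by fun_prop) fun l hl => ?_
          exact ENNReal.ofReal_le_ofReal (inv_anti₀ (by positivity) hl.1)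
      _ = 1 := by
          rw [setLIntegral_const, Real.volume_Icc, ← ENNReal.ofReal_mul (by positivity)]
          rw [show (‖z‖ / 2)⁻¹ * (‖z‖ - ‖z‖ / 2) = 1 by field_simp; norm_num]
          simp
  calc _ ≤ ∫⁻ z, F (x + z) := by
        refine lintegral_mono_ae ?_
        filter_upwards [Measure.ae_ne volume (0 : E3)] with z hz using h3 z hz
    _ = ∫⁻ y, F y := lintegral_add_left_eq_self F x

end Scaling

/-! ### Composition of two kernels `|y|⁻²` in three dimensions. -/

section Potential

theorem lintegral_ball_inv_sq_lt_top :
    ∫⁻ y in Metric.ball (0 : E3) (1 / 2), (‖y‖ₑ ^ 2)⁻¹ < ⊤ := by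
  have h : IntegrableOn (fun y : E3 => (‖y‖ ^ 2)⁻¹) (Metric.ball 0 (1 / 2)) := by
    rw [integrableOn_fun_norm_addHaar volume (f := fun r => (r ^ 2)⁻¹), finrank_euclideanSpace_fin]
    have : IntegrableOn (fun _ : ℝ => (1 : ℝ)) (Ioo 0 (1 / 2)) := by simp
    refine this.congr_fun (fun r hr => ?_) measurableSet_Ioo
    have : r ≠ 0 := hr.1.ne'
    simp [this]
  have h2 := h.2
  rw [HasFiniteIntegral] at h2
  refine lt_of_le_of_lt (lintegral_mono_ae ?_) h2
  filter_upwards [ae_restrict_of_ae (Measure.ae_ne volume (0 : E3))] with y hy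
  rw [enorm_inv (by simpa using hy), enorm_pow, enorm_norm]

theorem lintegral_compl_ball_inv_pow_lt_top :
    ∫⁻ y in (Metric.ball (0 : E3) (1 / 2))ᶜ, (‖y‖ₑ ^ 2)⁻¹ * (‖y‖ₑ ^ 2)⁻¹ < ⊤ := by
  have h : Integrable (fun y : E3 => (Ici (1 / 2 : ℝ)).indicator (fun r => (r ^ 4)⁻¹) ‖y‖) := by
    rw [integrable_fun_norm_addHaar volume (f := (Ici (1 / 2 : ℝ)).indicator (fun r => (r ^ 4)⁻¹)),
      finrank_euclideanSpace_fin]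
    have h1 : IntegrableOn (fun r : ℝ => r ^ (-2 : ℝ)) (Ici (1 / 2)) :=
      (integrableOn_Ici_iff_integrableOn_Ioi).2 (integrableOn_Ioi_rpow_of_lt (by norm_num) (by norm_num))
    rw [← integrable_indicator_iff measurableSet_Ici] at h1
    refine (h1.integrableOn (s := Ioi 0)).congr_fun (fun r hr => ?_) measurableSet_Ioi
    have hr : 0 < r := hr
    simp only [indicator, smul_eq_mul]
    split_ifs
    · rw [Real.rpow_neg hr.le]
      norm_num
      field_simp
    · simp
  have h2 := h.2
  rw [HasFiniteIntegral] at h2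
  rw [← lintegral_indicator Metric.isOpen_ball.measurableSet.compl]
  refine lt_of_le_of_lt (lintegral_mono fun y => ?_) h2
  simp only [indicator, mem_compl_iff, mem_ball_zero_iff, not_lt, mem_Ici]
  split_ifs with hy
  · have : y ≠ 0 := by rintro rfl; norm_num at hy
    rw [enorm_inv (by simpa using this), enorm_pow, enorm_norm,
      ← ENNReal.mul_inv (by simp [this]) (by simp)]
    ring_nf; rfl
  · simp

/-- The balls of radius `1/2` about `0` and `u` are disjoint. In either of them the other factor is
at most `4` and `|y|⁻²` is locally integrable; outside both, `a b ≤ a² + b²` leaves `|y|⁻⁴`,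
integrable at infinity. -/
theorem exists_lintegral_inv_sq_mul_inv_sq_le_of_norm_eq_one :
    ∃ K : ℝ≥0∞, K ≠ ⊤ ∧ ∀ u : E3, ‖u‖ = 1 →
      ∫⁻ y, (‖y‖ₑ ^ 2)⁻¹ * (‖y - u‖ₑ ^ 2)⁻¹ ≤ K := by
  set I := ∫⁻ y in Metric.ball (0 : E3) (1 / 2), (‖y‖ₑ ^ 2)⁻¹ with hI
  set J := ∫⁻ y in (Metric.ball (0 : E3) (1 / 2))ᶜ, (‖y‖ₑ ^ 2)⁻¹ * (‖y‖ₑ ^ 2)⁻¹ with hJ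
  have hIt : I ≠ ⊤ := lintegral_ball_inv_sq_lt_top.ne
  have hJt : J ≠ ⊤ := lintegral_compl_ball_inv_pow_lt_top.ne
  refine ⟨4 * I + 4 * I + (J + J), by finiteness, fun u hu => ?_⟩
  let f : E3 → ℝ≥0∞ := (Metric.ball (0 : E3) (1 / 2)).indicator fun y => (‖y‖ₑ ^ 2)⁻¹
  let g : E3 → ℝ≥0∞ := (Metric.ball (0 : E3) (1 / 2))ᶜ.indicator
    fun y => (‖y‖ₑ ^ 2)⁻¹ * (‖y‖ₑ ^ 2)⁻¹
  have hf : Measurable f := Measurable.indicator (by fun_prop) Metric.isOpen_ball.measurableSet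
  have hg : Measurable g :=
    Measurable.indicator (by fun_prop) Metric.isOpen_ball.measurableSet.compl
  have hfI : ∫⁻ y, f y = I := lintegral_indicator Metric.isOpen_ball.measurableSet _
  have hgJ : ∫⁻ y, g y = J := lintegral_indicator Metric.isOpen_ball.measurableSet.compl _
  have h4 : ∀ z : E3, 1 / 2 ≤ ‖z‖ → (‖z‖ₑ ^ 2)⁻¹ ≤ 4 := by
    intro z hz
    rw [← ofReal_norm, ← ENNReal.ofReal_pow (norm_nonneg _),
      ← ENNReal.ofReal_inv_of_pos (by positivity)]
    rw [show (4 : ℝ≥0∞) = ENNReal.ofReal 4 by norm_num]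
    refine ENNReal.ofReal_le_ofReal ?_
    rw [inv_le_comm₀ (by positivity) (by norm_num)]
    nlinarith
  have key : ∀ y, (‖y‖ₑ ^ 2)⁻¹ * (‖y - u‖ₑ ^ 2)⁻¹ ≤
      4 * f y + 4 * f (y - u) + (g y + g (y - u)) := by
    intro y
    by_cases h1 : ‖y‖ < 1 / 2
    · have h2 : 1 / 2 ≤ ‖y - u‖ := by
        have := norm_sub_norm_le u y
        rw [norm_sub_rev] at this; linarith
      have : f y = (‖y‖ₑ ^ 2)⁻¹ := indicator_of_mem (by simpa using h1) _
      rw [add_assoc]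
      refine le_add_right ?_
      rw [this, mul_comm]
      gcongr
      exact h4 _ h2
    · by_cases h2 : ‖y - u‖ < 1 / 2
      · have : f (y - u) = (‖y - u‖ₑ ^ 2)⁻¹ := indicator_of_mem (by simpa using h2) _
        refine le_add_right (le_add_left ?_)
        rw [this]
        gcongr
        exact h4 _ (not_lt.1 h1)
      · have e1 : g y = (‖y‖ₑ ^ 2)⁻¹ * (‖y‖ₑ ^ 2)⁻¹ := indicator_of_mem (by simpa using h1) _
        have e2 : g (y - u) = (‖y - u‖ₑ ^ 2)⁻¹ * (‖y - u‖ₑ ^ 2)⁻¹ :=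
          indicator_of_mem (by simpa using h2) _
        refine le_add_left ?_
        rw [e1, e2]
        rcases le_total (‖y‖ₑ ^ 2)⁻¹ (‖y - u‖ₑ ^ 2)⁻¹ with h | h
        · exact le_add_left (by gcongr)
        · exact le_add_right (by gcongr)
  calc _ ≤ ∫⁻ y, (4 * f y + 4 * f (y - u) + (g y + g (y - u))) := lintegral_mono key
    _ = _ := by
      rw [lintegral_add_left (by fun_prop), lintegral_add_left (by fun_prop),
        lintegral_add_left (by fun_prop), lintegral_const_mul _ hf,
        lintegral_const_mul _ (by fun_prop), lintegral_sub_right_eq_self f,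
        lintegral_sub_right_eq_self g, hfI, hgJ]

/-- Scaling by `‖p - q‖` reduces to distance one, with total exponent `3 - 2 - 2 = -1`. -/
theorem exists_lintegral_inv_sq_mul_inv_sq_le :
    ∃ K : ℝ≥0∞, K ≠ ⊤ ∧ ∀ p q : E3,
      ∫⁻ y, (‖y - p‖ₑ ^ 2)⁻¹ * (‖y - q‖ₑ ^ 2)⁻¹ ≤ (K + 1) * ‖p - q‖ₑ⁻¹ := by
  obtain ⟨K, hK, h⟩ := exists_lintegral_inv_sq_mul_inv_sq_le_of_norm_eq_one
  refine ⟨K, hK, fun p q => ?_⟩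
  -- For `p = q` the right side must be `⊤`; the factor `K + 1`, unlike `K`, cannot vanish.
  rcases eq_or_ne p q with rfl | hpq
  · simp
  set a := ‖q - p‖ with ha
  have ha0 : 0 < a := norm_pos_iff.2 (sub_ne_zero.2 hpq.symm)
  set u := a⁻¹ • (q - p) with hu
  have hu1 : ‖u‖ = 1 := by rw [hu, norm_smul, norm_inv, ha, norm_norm, inv_mul_cancel₀ ha0.ne']
  have hau : a • u = q - p := by rw [hu, smul_inv_smul₀ ha0.ne']
  have h1 : ∫⁻ y, (‖y - p‖ₑ ^ 2)⁻¹ * (‖y - q‖ₑ ^ 2)⁻¹ =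
      ∫⁻ z, (‖z‖ₑ ^ 2)⁻¹ * (‖z - a • u‖ₑ ^ 2)⁻¹ := by
    rw [← lintegral_add_right_eq_self _ p]
    refine lintegral_congr fun z => ?_
    rw [add_sub_cancel_right, hau, show z + p - q = z - (q - p) by abel]
  have h2 := lintegral_comp_smul_E3 (f := fun z => (‖z‖ₑ ^ 2)⁻¹ * (‖z - a • u‖ₑ ^ 2)⁻¹)
    (by fun_prop) ha0
  have h3 : ∀ z : E3, (‖a • z‖ₑ ^ 2)⁻¹ * (‖a • z - a • u‖ₑ ^ 2)⁻¹ =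
      ENNReal.ofReal ((a ^ 4)⁻¹) * ((‖z‖ₑ ^ 2)⁻¹ * (‖z - u‖ₑ ^ 2)⁻¹) := by
    intro z
    have h5 : ∀ w : E3, (‖a • w‖ₑ ^ 2)⁻¹ = ENNReal.ofReal ((a ^ 2)⁻¹) * (‖w‖ₑ ^ 2)⁻¹ := by
      intro w
      rw [enorm_smul, mul_pow, ENNReal.mul_inv (by simp [ha0.ne']) (by simp),
        ENNReal.ofReal_inv_of_pos (by positivity), ENNReal.ofReal_pow ha0.le,
        Real.enorm_of_nonneg ha0.le]
    rw [← smul_sub, h5, h5, show (a ^ 4)⁻¹ = (a ^ 2)⁻¹ * (a ^ 2)⁻¹ by rw [← mul_inv]; ring_nf,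
      ENNReal.ofReal_mul (by positivity)]
    ring
  simp_rw [h3] at h2
  rw [lintegral_const_mul _ (by fun_prop)] at h2
  have h6 : ∫⁻ z, (‖z‖ₑ ^ 2)⁻¹ * (‖z - a • u‖ₑ ^ 2)⁻¹ = ENNReal.ofReal a⁻¹ *
      ∫⁻ z, (‖z‖ₑ ^ 2)⁻¹ * (‖z - u‖ₑ ^ 2)⁻¹ := by
    have h7 := congrArg (fun t => ENNReal.ofReal (a ^ 3) * t) h2
    simp only [← mul_assoc] at h7
    rw [← ENNReal.ofReal_mul (by positivity), ← ENNReal.ofReal_mul (by positivity),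
      mul_inv_cancel₀ (by positivity), ENNReal.ofReal_one, one_mul] at h7
    rw [← h7]
    congr 2
    field_simp
  have h8 : ‖p - q‖ₑ⁻¹ = ENNReal.ofReal a⁻¹ := by
    rw [ENNReal.ofReal_inv_of_pos ha0, ha, norm_sub_rev, ofReal_norm]
  rw [h1, h6, h8, mul_comm]
  gcongr
  exact (h u hu1).trans le_self_add

end Potential

/-! ### Change of variables under an anti-Lipschitz map. -/

section Pushforward

theorem volume_image_le_of_lipschitzOn {K : NNReal} {g : E3 → E3} {T : Set E3}
    (hg : LipschitzOnWith K g T) : volume (g '' T) ≤ K ^ 3 * volume T := by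
  have h := hg.hausdorffMeasure_image_le (d := 3) (by norm_num)
  have : (μH[3] : Measure E3).IsAddHaarMeasure := by
    simpa using MeasureTheory.isAddHaarMeasure_hausdorffMeasure (E := E3)
  have hc := Measure.isAddLeftInvariant_eq_smul (volume : Measure E3) μH[3]
  rw [hc, Measure.smul_apply, Measure.smul_apply, ENNReal.smul_def, ENNReal.smul_def, smul_eq_mul,
    smul_eq_mul, mul_left_comm]
  gcongr
  simpa using h

/-- The inverse on the image is `K`-Lipschitz and enlarges volume by at most `K ^ 3`, so no
differentiability of `Φ` is needed. -/
theorem setLIntegral_comp_le_of_antilipschitzOn {S U : Set E3} (hS : MeasurableSet S)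
    {Φ : E3 → E3} {K : NNReal} (hΦ : ContinuousOn Φ S) (hSU : MapsTo Φ S U)
    (h : ∀ x ∈ S, ∀ y ∈ S, ‖x - y‖ ≤ K * ‖Φ x - Φ y‖) {F : E3 → ℝ≥0∞} (hF : Measurable F) :
    ∫⁻ x in S, F (Φ x) ≤ K ^ 3 * ∫⁻ y in U, F y := by
  have hm : AEMeasurable Φ (volume.restrict S) := hΦ.aemeasurable hS
  have hinj : InjOn Φ S := fun x hx y hy hxy => by
    have := h x hx y hy
    rw [hxy, sub_self, norm_zero, mul_zero] at this
    exact sub_eq_zero.1 (norm_le_zero_iff.1 this)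
  have hle : (volume.restrict S).map Φ ≤ ((K : ℝ≥0∞) ^ 3) • volume.restrict U := by
    refine Measure.le_iff.2 fun B hB => ?_
    rw [Measure.map_apply_of_aemeasurable hm hB, Measure.restrict_apply' hS, Measure.smul_apply,
      Measure.restrict_apply hB, smul_eq_mul]
    set T := Φ ⁻¹' B ∩ S
    have hTS : T ⊆ S := inter_subset_right
    have hlip : LipschitzOnWith K (Function.invFunOn Φ S) (Φ '' T) := by
      refine LipschitzOnWith.of_dist_le_mul ?_
      rintro _ ⟨x, hx, rfl⟩ _ ⟨y, hy, rfl⟩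
      rw [hinj.leftInvOn_invFunOn (hTS hx), hinj.leftInvOn_invFunOn (hTS hy), dist_eq_norm,
        dist_eq_norm]
      exact h x (hTS hx) y (hTS hy)
    have hT : Function.invFunOn Φ S '' (Φ '' T) = T :=
      (hinj.leftInvOn_invFunOn.mono hTS).image_image
    calc volume T = volume (Function.invFunOn Φ S '' (Φ '' T)) := by rw [hT]
      _ ≤ K ^ 3 * volume (Φ '' T) := volume_image_le_of_lipschitzOn hlip
      _ ≤ K ^ 3 * volume (B ∩ U) := by
        gcongr
        rintro _ ⟨x, hx, rfl⟩
        exact ⟨hx.1, hSU hx.2⟩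
  calc ∫⁻ x in S, F (Φ x) = ∫⁻ y, F y ∂(volume.restrict S).map Φ :=
        (lintegral_map' hF.aemeasurable hm).symm
    _ ≤ ∫⁻ y, F y ∂(((K : ℝ≥0∞) ^ 3) • volume.restrict U) := lintegral_mono' hle le_rfl
    _ = _ := by rw [lintegral_smul_measure, smul_eq_mul]

end Pushforward

/-! ### Increments along a path from pointwise slope bounds. -/

section Path

/-- A substitute for the fundamental theorem of calculus: `v ∘ Φ` along a ray is only locally
Lipschitz, but its slopes are bounded by a continuous function. -/
theorem norm_sub_le_intervalIntegral_of_slope {E : Type*} [NormedAddCommGroup E] {f : ℝ → E}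
    {g : ℝ → ℝ} {a b : ℝ} (hab : a ≤ b) {O : Set ℝ} (hO : IsOpen O) (hsub : Icc a b ⊆ O)
    (hg : ContinuousOn g O)
    (hf : ∀ x ∈ Icc a b, ∀ r, g x < r → ∀ᶠ z in 𝓝 x, ‖f z - f x‖ ≤ r * ‖z - x‖) :
    ‖f b - f a‖ ≤ ∫ x in a..b, g x := by
  have hfc : ∀ x ∈ Icc a b, ContinuousAt f x := by
    intro x hx
    rw [ContinuousAt, tendsto_iff_norm_sub_tendsto_zero]
    refine squeeze_zero' (Eventually.of_forall fun _ => norm_nonneg _)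
      (hf x hx (g x + 1) (by linarith)) ?_
    have : ContinuousAt (fun y : ℝ => (g x + 1) * ‖y - x‖) x := by fun_prop
    simpa [ContinuousAt] using this
  have hint : ∀ x ∈ Icc a b, IntervalIntegrable g volume a x := fun x hx =>
    (hg.mono (((uIcc_of_le hx.1).trans_subset (Icc_subset_Icc_right hx.2)).trans hsub)).intervalIntegrable
  have hB : ∀ x ∈ Icc a b, HasDerivAt (fun u => ∫ y in a..u, g y) (g x) x := fun x hx =>
    intervalIntegral.integral_hasDerivAt_right (hint x hx)
      (hg.stronglyMeasurableAtFilter hO x (hsub hx)) (hg.continuousAt (hO.mem_nhds (hsub hx)))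
  refine image_le_of_liminf_slope_right_le_deriv_boundary (f := fun x => ‖f x - f a‖)
    (B := fun u => ∫ y in a..u, g y) (B' := g) (a := a) (b := b) ?_ (by simp) ?_ ?_ ?_
    (right_mem_Icc.2 hab)
  · exact fun x hx => ((hfc x hx).sub continuousAt_const).norm.continuousWithinAt
  · exact fun x hx => (hB x hx).continuousAt.continuousWithinAt
  · exact fun x hx => (hB x (Ico_subset_Icc_self hx)).hasDerivWithinAt
  · intro x hx r hr
    obtain ⟨r', hr1, hr2⟩ := exists_between hr
    have h1 := (hf x (Ico_subset_Icc_self hx) r' hr1).filter_mono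
      (nhdsWithin_le_nhds (s := Ioi x))
    refine (h1.and self_mem_nhdsWithin).frequently.mono ?_
    rintro z ⟨hz, hzx⟩
    have hzx : 0 < z - x := sub_pos.2 hzx
    rw [slope_def_field, div_lt_iff₀ hzx]
    have h2 := norm_sub_norm_le (f z - f a) (f x - f a)
    rw [sub_sub_sub_cancel_right] at h2
    rw [Real.norm_of_nonneg hzx.le] at hz
    nlinarith

theorem enorm_sub_le_lintegral_of_slope {E : Type*} [NormedAddCommGroup E] {f : ℝ → E}
    {g : ℝ → ℝ} {a b : ℝ} (hab : a ≤ b) {O : Set ℝ} (hO : IsOpen O) (hsub : Icc a b ⊆ O)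
    (hg : ContinuousOn g O) (hg0 : ∀ x, 0 ≤ g x)
    (hf : ∀ x ∈ Icc a b, ∀ r, g x < r → ∀ᶠ z in 𝓝 x, ‖f z - f x‖ ≤ r * ‖z - x‖) :
    ‖f b - f a‖ₑ ≤ ∫⁻ x in Icc a b, ENNReal.ofReal (g x) := by
  have h := norm_sub_le_intervalIntegral_of_slope hab hO hsub hg hf
  have hi : IntegrableOn g (Icc a b) := (hg.mono hsub).integrableOn_Icc
  rw [← ofReal_norm, ← ofReal_integral_eq_lintegral_ofReal hi (Eventually.of_forall hg0)]
  refine ENNReal.ofReal_le_ofReal (h.trans_eq ?_)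
  rw [intervalIntegral.integral_of_le hab, integral_Icc_eq_integral_Ioc]

end Path

/-! ### The `L²` bound from the iterated kernel. -/

section Schur

/-- Boundedness of an integral operator with positive kernel `K : P × Y → [0, ∞]` from a bound for
the iterated kernel on `P × P`. -/
theorem lintegral_sq_lintegral_mul_le {P Y : Type*} [MeasurableSpace P] [MeasurableSpace Y]
    {μ : Measure P} {ν : Measure Y} [SFinite μ] [SFinite ν] (hμ : μ ≠ 0) {K : P → Y → ℝ≥0∞}
    (hK : Measurable (Function.uncurry K)) (hpos : ∀ p y, K p y ≠ 0) {M : ℝ≥0∞} (hM : M ≠ ⊤)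
    (h : ∀ p, ∫⁻ q, ∫⁻ y, K p y * K q y ∂ν ∂μ ≤ M) {F : Y → ℝ≥0∞} (hF : Measurable F) :
    ∫⁻ p, (∫⁻ y, F y * K p y ∂ν) ^ 2 ∂μ ≤ M * ∫⁻ y, F y ^ 2 ∂ν := by
  have hKp : ∀ p, Measurable (K p) := fun p => hK.of_uncurry_left
  have hKy : ∀ y, Measurable fun p => K p y := fun y => hK.of_uncurry_right
  let A : Y → ℝ≥0∞ := fun y => ∫⁻ q, K q y ∂μ
  have hA : Measurable A := hK.lintegral_prod_left'
  have hA0 : ∀ y, A y ≠ 0 := by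
    intro y hy
    rw [lintegral_eq_zero_iff (hKy y)] at hy
    apply hμ
    rw [← ae_eq_bot, ← empty_mem_iff_bot]
    filter_upwards [hy] with p hp using hpos p y hp
  have hrow : ∀ p, ∫⁻ y, K p y * A y ∂ν ≤ M := by
    intro p
    have : ∫⁻ q, ∫⁻ y, K p y * K q y ∂ν ∂μ = ∫⁻ y, K p y * A y ∂ν := by
      rw [lintegral_lintegral_swap]
      · exact lintegral_congr fun y => lintegral_const_mul _ (hKy y)
      · exact (Measurable.mul ((hKp p).comp measurable_snd) hK).aemeasurable
    exact this ▸ h p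
  -- Cauchy–Schwarz for `F K = (F² K / A)^(1/2) (K A)^(1/2)`. The second factor is the row integral
  -- of the iterated kernel, and integrating `K p y / A y` in `p` gives at most `1`. Division by `A`
  -- is legitimate: it is positive because `K` is, and finite almost everywhere by `hrow`.
  have hcs : ∀ p, (∫⁻ y, F y * K p y ∂ν) ^ 2 ≤ M * ∫⁻ y, F y ^ 2 * K p y / A y ∂ν := by
    intro p
    have hAt : ∀ᵐ y ∂ν, A y ≠ ⊤ := by
      filter_upwards [ae_lt_top ((hKp p).mul hA) ((hrow p).trans_lt hM.lt_top).ne] with y hy hAy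
      simp [hAy, hpos p y] at hy
    have h1 : ∫⁻ y, F y * K p y ∂ν =
        ∫⁻ y, ((fun y => (F y ^ 2 * K p y / A y) ^ (1 / 2 : ℝ)) *
          fun y => (K p y * A y) ^ (1 / 2 : ℝ)) y ∂ν := by
      refine lintegral_congr_ae ?_
      filter_upwards [hAt] with y hy
      rw [Pi.mul_apply, ← ENNReal.mul_rpow_of_nonneg _ _ (by norm_num),
        show F y ^ 2 * K p y / A y * (K p y * A y) = (F y * K p y) ^ 2 * (A y / A y) by
          rw [div_eq_mul_inv, div_eq_mul_inv]; ring, ENNReal.div_self (hA0 y) hy, mul_one,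
        ← ENNReal.rpow_natCast, ← ENNReal.rpow_mul]
      norm_num
    have hq1 : Measurable fun y => F y ^ 2 * K p y / A y := ((hF.pow_const 2).mul (hKp p)).div hA
    have hq2 : Measurable fun y => K p y * A y := (hKp p).mul hA
    have h2 := ENNReal.lintegral_mul_le_Lp_mul_Lq ν Real.HolderConjugate.two_two
      (f := fun y => (F y ^ 2 * K p y / A y) ^ (1 / 2 : ℝ))
      (g := fun y => (K p y * A y) ^ (1 / 2 : ℝ))
      (hq1.pow_const _).aemeasurable (hq2.pow_const _).aemeasurable
    rw [← h1] at h2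
    simp only [← ENNReal.rpow_mul] at h2
    norm_num at h2
    calc (∫⁻ y, F y * K p y ∂ν) ^ 2 ≤ ((∫⁻ y, F y ^ 2 * K p y / A y ∂ν) ^ (1 / 2 : ℝ) *
          (∫⁻ y, K p y * A y ∂ν) ^ (1 / 2 : ℝ)) ^ 2 := by gcongr
      _ = (∫⁻ y, K p y * A y ∂ν) * ∫⁻ y, F y ^ 2 * K p y / A y ∂ν := by
        rw [mul_pow, ← ENNReal.rpow_natCast, ← ENNReal.rpow_natCast, ← ENNReal.rpow_mul,
          ← ENNReal.rpow_mul]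
        norm_num [mul_comm]
      _ ≤ _ := by gcongr; exact hrow p
  calc ∫⁻ p, (∫⁻ y, F y * K p y ∂ν) ^ 2 ∂μ ≤ ∫⁻ p, M * ∫⁻ y, F y ^ 2 * K p y / A y ∂ν ∂μ :=
        lintegral_mono hcs
    _ = M * ∫⁻ p, ∫⁻ y, F y ^ 2 * K p y / A y ∂ν ∂μ := lintegral_const_mul' _ _ hM
    _ = M * ∫⁻ y, ∫⁻ p, F y ^ 2 * K p y / A y ∂μ ∂ν := by
        rw [lintegral_lintegral_swap]
        exact ((((hF.pow_const 2).comp measurable_snd).mul hK).div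
          (hA.comp measurable_snd)).aemeasurable
    _ ≤ M * ∫⁻ y, F y ^ 2 ∂ν := by
        gcongr with y
        have : ∀ p, F y ^ 2 * K p y / A y = F y ^ 2 / A y * K p y := fun p => by
          rw [div_eq_mul_inv, div_eq_mul_inv]; ring
        simp_rw [this]
        rw [lintegral_const_mul _ (hKy y)]
        change F y ^ 2 / A y * A y ≤ F y ^ 2
        rw [ENNReal.mul_comm_div]
        exact mul_le_of_le_one_right zero_le ENNReal.div_self_le_one

end Schur

/-! ### One-dimensional integrals on the circle and in the angle. -/

section OneDimensional

theorem setLIntegral_norm_circle (φ : ℝ → ℝ≥0∞) (s : ℝ) :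
    ∫⁻ t in Ico (0 : ℝ) 1, φ ‖((s - t : ℝ) : UnitAddCircle)‖ =
      ∫⁻ τ in Ioc (-(1 / 2) : ℝ) (1 / 2), φ |τ| := by
  rw [restrict_Ico_eq_restrict_Ioc]
  have h1 := UnitAddCircle.lintegral_preimage 0 fun b => φ ‖(s : UnitAddCircle) - b‖
  have h2 := UnitAddCircle.lintegral_preimage (-(1 / 2)) fun b => φ ‖b‖
  have h3 := lintegral_sub_left_eq_self (μ := (volume : Measure UnitAddCircle))
    (fun b => φ ‖b‖) (s : UnitAddCircle)
  rw [zero_add] at h1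
  rw [show (-(1 / 2) + 1 : ℝ) = 1 / 2 by norm_num] at h2
  simp only [← AddCircle.coe_sub] at h1
  rw [h1, h3, ← h2]
  refine setLIntegral_congr_fun measurableSet_Ioc fun τ hτ => ?_
  have : ‖(τ : UnitAddCircle)‖ = |τ| := by
    rw [AddCircle.norm_coe_eq_abs_iff (p := 1) (x := τ) one_ne_zero]
    rw [abs_le]; norm_num
    exact ⟨by linarith [hτ.1], by linarith [hτ.2]⟩
  simp only [this]

theorem setLIntegral_comp_abs (φ : ℝ → ℝ≥0∞) {a : ℝ} (ha : 0 ≤ a) :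
    ∫⁻ τ in Ioc (-a) a, φ |τ| = 2 * ∫⁻ τ in Ioc 0 a, φ τ := by
  rw [← Ioc_union_Ioc_eq_Ioc (neg_nonpos.2 ha) ha, lintegral_union measurableSet_Ioc
    (Ioc_disjoint_Ioc_of_le le_rfl), two_mul]
  congr 1
  · have h1 := (Measure.measurePreserving_neg (volume : Measure ℝ)).setLIntegral_comp_preimage_emb
      (MeasurableEquiv.neg ℝ).measurableEmbedding φ (Ico 0 a)
    rw [← restrict_Ico_eq_restrict_Ioc (a := 0), ← h1]
    have h2 : (Neg.neg ⁻¹' Ico 0 a : Set ℝ) = Ioc (-a) 0 := by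
      ext x; simp
    rw [h2]
    refine setLIntegral_congr_fun measurableSet_Ioc fun τ hτ => ?_
    simp only [abs_of_nonpos hτ.2]
  · refine setLIntegral_congr_fun measurableSet_Ioc fun τ hτ => ?_
    simp only [abs_of_pos hτ.1]

theorem setLIntegral_Ioc_periodic {T : ℝ} (hT : 0 < T) {f : ℝ → ℝ≥0∞} (hf : Function.Periodic f T)
    (s t : ℝ) : ∫⁻ x in Ioc s (s + T), f x = ∫⁻ x in Ioc t (t + T), f x := by
  have : VAddInvariantMeasure (AddSubgroup.zmultiples T) ℝ volume :=
    ⟨fun c s _ => measure_preimage_add _ _ _⟩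
  exact (isAddFundamentalDomain_Ioc hT s).setLIntegral_eq (isAddFundamentalDomain_Ioc hT t) f
    hf.map_vadd_zmultiples

theorem lintegral_inv_sqrt_Ioc_lt_top {a : ℝ} :
    ∫⁻ x in Ioc 0 a, ENNReal.ofReal (x ^ (-(1 / 2) : ℝ)) < ⊤ := by
  have h : IntervalIntegrable (fun x : ℝ => x ^ (-(1 / 2) : ℝ)) volume 0 a :=
    intervalIntegral.intervalIntegrable_rpow' (by norm_num)
  exact h.1.lintegral_lt_top

theorem lintegral_inv_sqrt_sin_lt_top :
    ∫⁻ x in Ioc 0 (Real.pi / 2), ((‖Real.sin x‖ₑ) ^ (1 / 2 : ℝ))⁻¹ < ⊤ := by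
  have hle : ∫⁻ x in Ioc 0 (Real.pi / 2), ((‖Real.sin x‖ₑ) ^ (1 / 2 : ℝ))⁻¹ ≤
      ∫⁻ x in Ioc 0 (Real.pi / 2), ENNReal.ofReal ((2 / Real.pi) ^ (-(1 / 2) : ℝ)) *
        ENNReal.ofReal (x ^ (-(1 / 2) : ℝ)) := by
    refine setLIntegral_mono (by fun_prop) fun x hx => ?_
    have hpi := Real.pi_pos
    have hx0 : 0 < x := hx.1
    have h1 := Real.mul_le_sin hx.1.le hx.2
    have h2 : 0 < 2 / Real.pi * x := by positivity
    have h3 : 0 < Real.sin x := h2.trans_le h1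
    rw [Real.enorm_of_nonneg h3.le, ENNReal.ofReal_rpow_of_pos h3, ← ENNReal.ofReal_inv_of_pos
      (by positivity), ← Real.rpow_neg h3.le, ← ENNReal.ofReal_mul (by positivity),
      ← Real.mul_rpow (by positivity) hx0.le]
    exact ENNReal.ofReal_le_ofReal (Real.rpow_le_rpow_of_nonpos h2 h1 (by norm_num))
  refine hle.trans_lt ?_
  rw [lintegral_const_mul _ (by fun_prop)]
  exact ENNReal.mul_lt_top ENNReal.ofReal_lt_top lintegral_inv_sqrt_Ioc_lt_top

/-- By `π`-periodicity the shift `α` is immaterial, and `[0, 2π)` is four copies of `(0, π/2]` up to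
reflection and null sets. -/
theorem exists_lintegral_inv_sqrt_sin_le : ∃ C : ℝ≥0∞, C ≠ ⊤ ∧ ∀ α : ℝ,
    ∫⁻ φ in Ico 0 (2 * Real.pi), ((‖Real.sin (φ - α)‖ₑ) ^ (1 / 2 : ℝ))⁻¹ ≤ C := by
  refine ⟨_, (ENNReal.mul_lt_top (ENNReal.natCast_lt_top 4) lintegral_inv_sqrt_sin_lt_top).ne,
    fun α => ?_⟩
  have hpi := Real.pi_pos
  set f : ℝ → ℝ≥0∞ := fun φ => ((‖Real.sin (φ - α)‖ₑ) ^ (1 / 2 : ℝ))⁻¹ with hf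
  have hper : Function.Periodic f Real.pi := by
    intro φ
    simp only [hf]
    rw [show φ + Real.pi - α = φ - α + Real.pi by ring, Real.sin_add_pi, enorm_neg]
  have h1 : ∫⁻ φ in Ioc (α - Real.pi / 2) (α - Real.pi / 2 + Real.pi), f φ =
      2 * ∫⁻ x in Ioc 0 (Real.pi / 2), ((‖Real.sin x‖ₑ) ^ (1 / 2 : ℝ))⁻¹ := by
    rw [← setLIntegral_comp_abs (fun x => ((‖Real.sin x‖ₑ) ^ (1 / 2 : ℝ))⁻¹) (by positivity)]
    have h2 := (measurePreserving_sub_right (volume : Measure ℝ) α).setLIntegral_comp_preimage_emb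
      (MeasurableEquiv.subRight α).measurableEmbedding
      (fun x => ((‖Real.sin |x|‖ₑ) ^ (1 / 2 : ℝ))⁻¹) (Ioc (-(Real.pi / 2)) (Real.pi / 2))
    rw [← h2]
    have h3 : ((fun x => x - α) ⁻¹' Ioc (-(Real.pi / 2)) (Real.pi / 2) : Set ℝ) =
        Ioc (α - Real.pi / 2) (α - Real.pi / 2 + Real.pi) := by
      ext x; simp only [mem_preimage, mem_Ioc]
      constructor <;> rintro ⟨h, h'⟩ <;> constructor <;> linarith
    rw [h3]
    refine lintegral_congr fun x => ?_
    simp only [hf]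
    rcases abs_choice (x - α) with h | h <;> rw [h]
    rw [Real.sin_neg, enorm_neg]
  rw [restrict_Ico_eq_restrict_Ioc, ← Ioc_union_Ioc_eq_Ioc hpi.le (by linarith),
    lintegral_union measurableSet_Ioc (Ioc_disjoint_Ioc_of_le le_rfl)]
  have h4 := setLIntegral_Ioc_periodic hpi hper 0 (α - Real.pi / 2)
  have h5 := setLIntegral_Ioc_periodic hpi hper Real.pi (α - Real.pi / 2)
  rw [zero_add] at h4
  rw [← two_mul] at h5
  rw [h4, h5, h1, ← mul_two, mul_right_comm]
  norm_num

theorem lintegral_inv_add_sq_le {ε c : ℝ} (hε : 0 < ε) (hc : 0 < c) (a : ℝ) (ha : 0 ≤ a) :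
    ∫⁻ τ in Ioc (-a) a, ENNReal.ofReal ((ε ^ 2 + (c * |τ|) ^ 2)⁻¹) ≤
      ENNReal.ofReal (Real.pi / (c * ε)) := by
  have hcont : Continuous fun τ : ℝ => (ε ^ 2 + (c * |τ|) ^ 2)⁻¹ := by
    refine Continuous.inv₀ (by fun_prop) fun τ => ?_
    positivity
  rw [← ofReal_integral_eq_lintegral_ofReal hcont.integrableOn_Ioc
    (Eventually.of_forall fun τ => by positivity), ← intervalIntegral.integral_of_le (by linarith)]
  refine ENNReal.ofReal_le_ofReal ?_
  have hd : ∀ τ ∈ uIcc (-a) a, HasDerivAt (fun τ => (c * ε)⁻¹ * Real.arctan (c / ε * τ))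
      ((ε ^ 2 + (c * |τ|) ^ 2)⁻¹) τ := by
    intro τ _
    have h1 := (((hasDerivAt_id τ).const_mul (c / ε)).arctan).const_mul (c * ε)⁻¹
    convert! h1 using 1
    simp only [id, mul_one, mul_pow, sq_abs, div_pow]
    field_simp
  rw [intervalIntegral.integral_eq_sub_of_hasDerivAt hd (hcont.intervalIntegrable _ _), ← mul_sub,
    div_eq_inv_mul Real.pi]
  refine mul_le_mul_of_nonneg_left ?_ (by positivity)
  linarith [Real.arctan_lt_pi_div_two (c / ε * a), Real.neg_pi_div_two_lt_arctan (c / ε * -a)]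

/-- The logarithm of the theorem arises here, from `τ⁻¹` on `(η, 1/2]`; the part `τ < η` contributes
only a constant. -/
theorem setLIntegral_split_le {η B : ℝ} {A : ℝ≥0∞} (hη : 0 < η) (hη' : η ≤ 1 / 2) (hB : 0 ≤ B) :
    ∫⁻ τ in Ioc 0 (1 / 2 : ℝ), (if τ < η then A * ENNReal.ofReal ((η * τ) ^ (-(1 / 2) : ℝ))
      else ENNReal.ofReal (B * τ⁻¹)) ≤ 2 * A + ENNReal.ofReal (B * Real.log η⁻¹) := by
  rw [← Ioc_union_Ioc_eq_Ioc hη.le hη', lintegral_union measurableSet_Ioc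
    (Ioc_disjoint_Ioc_of_le le_rfl), ← restrict_Ioo_eq_restrict_Ioc]
  gcongr
  · have h1 : ∫⁻ τ in Ioo 0 η, (if τ < η then A * ENNReal.ofReal ((η * τ) ^ (-(1 / 2) : ℝ))
        else ENNReal.ofReal (B * τ⁻¹)) =
        ∫⁻ τ in Ioo 0 η, A * (ENNReal.ofReal (η ^ (-(1 / 2) : ℝ)) *
          ENNReal.ofReal (τ ^ (-(1 / 2) : ℝ))) := by
      refine setLIntegral_congr_fun measurableSet_Ioo fun τ hτ => ?_
      simp only [hτ.2, if_true]
      rw [Real.mul_rpow hη.le hτ.1.le, ENNReal.ofReal_mul (by positivity)]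
    have h : IntervalIntegrable (fun x : ℝ => x ^ (-(1 / 2) : ℝ)) volume 0 η :=
      intervalIntegral.intervalIntegrable_rpow' (by norm_num)
    rw [h1, lintegral_const_mul _ (by fun_prop), lintegral_const_mul _ (by fun_prop),
      restrict_Ioo_eq_restrict_Ioc, ← ofReal_integral_eq_lintegral_ofReal h.1
      ((ae_restrict_iff' measurableSet_Ioc).2 (Eventually.of_forall fun x hx =>
        Real.rpow_nonneg hx.1.le _)), ← intervalIntegral.integral_of_le hη.le,
      integral_rpow (Or.inl (by norm_num)), ← ENNReal.ofReal_mul (by positivity), mul_comm 2 A]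
    gcongr
    rw [show (2 : ℝ≥0∞) = ENNReal.ofReal 2 by norm_num]
    refine ENNReal.ofReal_le_ofReal (le_of_eq ?_)
    norm_num
    rw [Real.rpow_neg hη.le]
    have : 0 < η ^ (1 / 2 : ℝ) := by positivity
    field_simp
  · have h1 : ∀ τ ∈ Ioc η (1 / 2), (if τ < η then A * ENNReal.ofReal ((η * τ) ^ (-(1 / 2) : ℝ))
        else ENNReal.ofReal (B * τ⁻¹)) = ENNReal.ofReal (B * τ⁻¹) := by
      intro τ hτ
      simp [hτ.1.not_gt]
    rw [setLIntegral_congr_fun measurableSet_Ioc h1]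
    have hi : IntervalIntegrable (fun τ : ℝ => B * τ⁻¹) volume η (1 / 2) := by
      refine ContinuousOn.intervalIntegrable ?_
      refine continuousOn_const.mul (continuousOn_inv₀.mono fun x hx => ?_)
      rw [uIcc_of_le hη'] at hx
      exact (hη.trans_le hx.1).ne'
    rw [← ofReal_integral_eq_lintegral_ofReal hi.1
      ((ae_restrict_iff' measurableSet_Ioc).2 (Eventually.of_forall fun x hx =>
        mul_nonneg hB (inv_nonneg.2 (hη.le.trans hx.1.le)))),
      ← intervalIntegral.integral_of_le hη']
    refine ENNReal.ofReal_le_ofReal ?_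
    rw [intervalIntegral.integral_const_mul, integral_inv_of_pos hη (by norm_num)]
    gcongr
    rw [div_eq_inv_mul]
    have := inv_pos.2 hη
    linarith

end OneDimensional

/-! ### The integral of the inverse distance over the thin tube. -/

section SurfaceKernel

variable {X e₁ e₂ : ℝ → E3} {κmax cΓ : ℝ}

/-- Let `α` be the polar angle of the projection of `z` to the normal plane. The component along
`e_ρ(t, α + π/2)` annihilates `z` and equals `sin (φ - α)` on `e_ρ(t, φ)`. -/
theorem IsFrame.exists_abs_sin_le (hF : IsFrame X e₁ e₂) (t : ℝ) (z : E3) :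
    ∃ α, ∀ φ, |Real.sin (φ - α)| ≤ ‖z - eRho e₁ e₂ t φ‖ := by
  set a := inner ℝ (e₁ t) z with ha
  set b := inner ℝ (e₂ t) z with hb
  refine ⟨Complex.arg ⟨a, b⟩, fun φ => ?_⟩
  set α := Complex.arg ⟨a, b⟩ with hα
  have hcos : ‖(⟨a, b⟩ : ℂ)‖ * Real.cos α = a := Complex.norm_mul_cos_arg _
  have hsin : ‖(⟨a, b⟩ : ℂ)‖ * Real.sin α = b := Complex.norm_mul_sin_arg _
  have hn := (hF.isUnitNormal_eRho t (α + Real.pi / 2)).1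
  have h1 := abs_real_inner_le_norm (eRho e₁ e₂ t (α + Real.pi / 2)) (z - eRho e₁ e₂ t φ)
  rw [hn, one_mul] at h1
  refine le_trans (le_of_eq ?_) h1
  rw [← abs_neg]
  congr 1
  have h11 : inner ℝ (e₁ t) (e₁ t) = (1 : ℝ) := by rw [real_inner_self_eq_norm_sq, hF.norm₁]; norm_num
  have h22 : inner ℝ (e₂ t) (e₂ t) = (1 : ℝ) := by rw [real_inner_self_eq_norm_sq, hF.norm₂]; norm_num
  have h12 := hF.inner₁₂ t
  have h21 : inner ℝ (e₂ t) (e₁ t) = (0 : ℝ) := by rw [real_inner_comm]; exact h12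
  simp only [eRho, inner_add_left, inner_sub_right, inner_add_right, inner_smul_left,
    inner_smul_right, h11, h22, h12, h21, ← ha, ← hb, Real.cos_add_pi_div_two,
    Real.sin_add_pi_div_two, Real.sin_sub, conj_trivial]
  linear_combination (-Real.sin α) * hcos + Real.cos α * hsin

theorem continuous_surface (hX : IsCenterline κmax cΓ X) (hF : IsFrame X e₁ e₂) (η : ℝ) :
    Continuous (surface X e₁ e₂ η) := by
  have h0 := hX.differentiable.continuous
  have h1 := hF.contDiff₁.continuous
  have h2 := hF.contDiff₂.continuous
  unfold surface eRho
  fun_prop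

/-- The coordinate rectangle of the fiber surface. -/
abbrev surfaceDomain : Set (ℝ × ℝ) := Ico (0 : ℝ) 1 ×ˢ Ico (0 : ℝ) (2 * Real.pi)

/-- At arclength distance `τ ≥ η` the lower bound `c τ` on the distance suffices. For `τ < η` the
distance also dominates `η |sin (φ - α)|`, and the geometric mean of the two lower bounds has an
inverse that is integrable in both variables. -/
theorem exists_lintegral_inv_surface_le (cΓ δ : ℝ) (hcΓ : 0 < cΓ) (hδ : 0 < δ) (hδ1 : δ ≤ 1) :
    ∃ M : ℝ, 0 < M ∧ ∀ (κmax : ℝ) (X e₁ e₂ : ℝ → E3) (ε : ℝ), IsCenterline κmax cΓ X →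
      IsFrame X e₁ e₂ → 0 < ε → HasReach X (4 * ε) → ∀ p : ℝ × ℝ,
      ∫⁻ q in surfaceDomain, ‖surface X e₁ e₂ (δ * ε) p - surface X e₁ e₂ (δ * ε) q‖ₑ⁻¹ ≤
        ENNReal.ofReal (M * |Real.log ε|) := by
  obtain ⟨C₀, hC₀, hsin⟩ := exists_lintegral_inv_sqrt_sin_le
  set C := C₀.toReal
  have hC : ENNReal.ofReal C = C₀ := ENNReal.ofReal_toReal hC₀
  have hpi := Real.pi_pos
  set c := cΓ / 2 with hc
  have hc0 : 0 < c := by positivity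
  set A : ℝ := C * c ^ (-(1 / 2) : ℝ) with hA
  have hA0 : 0 ≤ A := by positivity
  set B : ℝ := 2 * Real.pi * c⁻¹ with hB
  have hB0 : 0 < B := by positivity
  refine ⟨2 * (2 * A + B * (Real.log δ⁻¹ + 1)), ?_, ?_⟩
  · have : 0 ≤ Real.log δ⁻¹ := Real.log_nonneg ((one_le_inv₀ hδ).2 hδ1)
    positivity
  intro κmax X e₁ e₂ ε hX hF hε hR p
  set η := δ * ε with hη
  have hη0 : 0 < η := by positivity
  have hηε : η ≤ ε := by nlinarith
  have hε8 : ε ≤ 1 / 8 := by have := hR.one_ge hX hcΓ; linarith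
  have hcont := continuous_surface hX hF η
  have hmeas : Measurable fun q : ℝ × ℝ => ‖surface X e₁ e₂ η p - surface X e₁ e₂ η q‖ₑ⁻¹ := by
    have := hcont.measurable
    fun_prop
  have hvol : (volume : Measure (ℝ × ℝ)).restrict surfaceDomain =
      (volume.restrict (Ico (0 : ℝ) 1)).prod (volume.restrict (Ico 0 (2 * Real.pi))) := by
    rw [Measure.volume_eq_prod, Measure.prod_restrict]
  rw [hvol, lintegral_prod _ hmeas.aemeasurable]
  set ψ : ℝ → ℝ≥0∞ := fun τ => if τ < η then
    ENNReal.ofReal A * ENNReal.ofReal ((η * τ) ^ (-(1 / 2) : ℝ)) else ENNReal.ofReal (B * τ⁻¹) with hψ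
  have hinner : ∀ t : ℝ, 0 < ‖((p.1 - t : ℝ) : UnitAddCircle)‖ →
      ∫⁻ φ in Ico 0 (2 * Real.pi), ‖surface X e₁ e₂ η p - surface X e₁ e₂ η (t, φ)‖ₑ⁻¹ ≤
        ψ ‖((p.1 - t : ℝ) : UnitAddCircle)‖ := by
    intro t ht
    set τ := ‖((p.1 - t : ℝ) : UnitAddCircle)‖ with hτ
    have hnon := hX.non_intersecting p.1 t
    rw [← hτ] at hnon
    have hsq : ∀ φ, ‖X p.1 - X t‖ ^ 2 / 2 + η ^ 2 * ‖eRho e₁ e₂ p.1 p.2 - eRho e₁ e₂ t φ‖ ^ 2 ≤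
        ‖surface X e₁ e₂ η p - surface X e₁ e₂ η (t, φ)‖ ^ 2 := fun φ =>
      hR.sq_norm_sub_ge hη0 hηε (hF.isUnitNormal_eRho _ _) (hF.isUnitNormal_eRho _ _)
    have hfar : ∀ φ, c * τ ≤ ‖surface X e₁ e₂ η p - surface X e₁ e₂ η (t, φ)‖ := by
      intro φ
      refine le_of_sq_le_sq ?_ (norm_nonneg _)
      have h1 := hsq φ
      have h2 : (cΓ * τ) ^ 2 ≤ ‖X p.1 - X t‖ ^ 2 := by gcongr
      have h3 : 0 ≤ η ^ 2 * ‖eRho e₁ e₂ p.1 p.2 - eRho e₁ e₂ t φ‖ ^ 2 := by positivity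
      rw [hc]
      nlinarith [sq_nonneg (cΓ * τ)]
    simp only [hψ]
    split_ifs with hlt
    · obtain ⟨α, hα⟩ := hF.exists_abs_sin_le t (eRho e₁ e₂ p.1 p.2)
      have hnear : ∀ φ, η * |Real.sin (φ - α)| ≤
          ‖surface X e₁ e₂ η p - surface X e₁ e₂ η (t, φ)‖ := by
        intro φ
        refine le_of_sq_le_sq ?_ (norm_nonneg _)
        have h1 := hsq φ
        have h2 : (η * |Real.sin (φ - α)|) ^ 2 ≤
            (η * ‖eRho e₁ e₂ p.1 p.2 - eRho e₁ e₂ t φ‖) ^ 2 := by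
          gcongr; exact hα φ
        nlinarith [sq_nonneg ‖X p.1 - X t‖]
      have hpt : ∀ φ, ‖surface X e₁ e₂ η p - surface X e₁ e₂ η (t, φ)‖ₑ⁻¹ ≤
          ENNReal.ofReal ((c * τ * η) ^ (-(1 / 2) : ℝ)) *
            ((‖Real.sin (φ - α)‖ₑ) ^ (1 / 2 : ℝ))⁻¹ := by
        intro φ
        have hpos : 0 < c * τ * η := by positivity
        set N := ‖surface X e₁ e₂ η p - surface X e₁ e₂ η (t, φ)‖ with hN
        have h3 : c * τ * η * |Real.sin (φ - α)| ≤ N ^ 2 := by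
          calc c * τ * η * |Real.sin (φ - α)| = (c * τ) * (η * |Real.sin (φ - α)|) := by ring
            _ ≤ N * N := mul_le_mul (hfar φ) (hnear φ) (by positivity) (norm_nonneg _)
            _ = N ^ 2 := by ring
        have h4 : ENNReal.ofReal (c * τ * η) ^ (1 / 2 : ℝ) * ‖Real.sin (φ - α)‖ₑ ^ (1 / 2 : ℝ) ≤
            ‖surface X e₁ e₂ η p - surface X e₁ e₂ η (t, φ)‖ₑ := by
          rw [← ENNReal.mul_rpow_of_nonneg _ _ (by norm_num), ← ofReal_norm, ← ofReal_norm, ← hN,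
            Real.norm_eq_abs, ← ENNReal.ofReal_mul hpos.le]
          calc _ ≤ ENNReal.ofReal (N ^ 2) ^ (1 / 2 : ℝ) := by gcongr
            _ = ENNReal.ofReal N := by
              rw [ENNReal.ofReal_rpow_of_nonneg (by positivity) (by norm_num), ← Real.sqrt_eq_rpow,
                Real.sqrt_sq (norm_nonneg _)]
        have hne : ENNReal.ofReal (c * τ * η) ^ (1 / 2 : ℝ) ≠ 0 := by
          simp [ENNReal.rpow_eq_zero_iff, hpos]
        have hnt : ENNReal.ofReal (c * τ * η) ^ (1 / 2 : ℝ) ≠ ⊤ := by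
          simp [ENNReal.rpow_eq_top_iff]
        rw [Real.rpow_neg hpos.le, ENNReal.ofReal_inv_of_pos (by positivity),
          ← ENNReal.ofReal_rpow_of_pos hpos, ← ENNReal.mul_inv (Or.inl hne) (Or.inl hnt)]
        exact ENNReal.inv_le_inv.2 h4
      calc _ ≤ ∫⁻ φ in Ico 0 (2 * Real.pi), ENNReal.ofReal ((c * τ * η) ^ (-(1 / 2) : ℝ)) *
            ((‖Real.sin (φ - α)‖ₑ) ^ (1 / 2 : ℝ))⁻¹ := lintegral_mono hpt
        _ ≤ ENNReal.ofReal ((c * τ * η) ^ (-(1 / 2) : ℝ)) * C₀ := by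
          rw [lintegral_const_mul _ (by fun_prop)]
          gcongr
          exact hsin α
        _ = _ := by
          rw [← hC, ← ENNReal.ofReal_mul (by positivity), ← ENNReal.ofReal_mul hA0, hA,
            mul_assoc c τ η, mul_comm τ η, Real.mul_rpow hc0.le (by positivity)]
          congr 1
          ring
    · calc _ ≤ ∫⁻ φ in Ico 0 (2 * Real.pi), ENNReal.ofReal ((c * τ)⁻¹) := by
            refine lintegral_mono fun φ => ?_
            have : 0 < c * τ := by positivity
            rw [← ofReal_norm, ENNReal.ofReal_inv_of_pos this]
            exact ENNReal.inv_le_inv.2 (ENNReal.ofReal_le_ofReal (hfar φ))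
        _ = _ := by
          rw [setLIntegral_const, Real.volume_Ico, ← ENNReal.ofReal_mul (by positivity), hB, sub_zero,
            mul_inv]
          congr 1
          ring
  have hne : ∀ᵐ t : ℝ, 0 < ‖((p.1 - t : ℝ) : UnitAddCircle)‖ := by
    have hcount : (range fun n : ℤ => p.1 - n).Countable := countable_range _
    filter_upwards [hcount.ae_notMem volume] with t ht
    rw [norm_pos_iff]
    intro h0
    rw [AddCircle.coe_eq_zero_iff] at h0
    obtain ⟨n, hn⟩ := h0
    refine ht ⟨n, ?_⟩
    simp at hn
    simp only; linarith
  calc _ ≤ ∫⁻ t in Ico (0 : ℝ) 1, ψ ‖((p.1 - t : ℝ) : UnitAddCircle)‖ := by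
        refine lintegral_mono_ae ?_
        filter_upwards [ae_restrict_of_ae hne] with t ht using hinner t ht
    _ = 2 * ∫⁻ τ in Ioc 0 (1 / 2 : ℝ), ψ τ := by
        rw [setLIntegral_norm_circle, setLIntegral_comp_abs _ (by norm_num)]
    _ ≤ 2 * (2 * ENNReal.ofReal A + ENNReal.ofReal (B * Real.log η⁻¹)) := by
        gcongr
        exact setLIntegral_split_le hη0 (by linarith) hB0.le
    _ = ENNReal.ofReal (2 * (2 * A + B * Real.log η⁻¹)) := by
        have : 0 ≤ Real.log η⁻¹ := Real.log_nonneg ((one_le_inv₀ hη0).2 (by linarith))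
        rw [ENNReal.ofReal_mul zero_le_two, ENNReal.ofReal_add (by positivity) (by positivity),
          ENNReal.ofReal_mul zero_le_two]
        norm_num
    _ ≤ _ := by
        refine ENNReal.ofReal_le_ofReal ?_
        -- As `ε ≤ 1/8`, the constants `2 A` and `B log δ⁻¹` are absorbed into multiples of `|log
        -- ε|`.
        have hlog : 1 ≤ Real.log ε⁻¹ := by
          rw [Real.le_log_iff_exp_le (by positivity)]
          have : (8 : ℝ) ≤ ε⁻¹ := by rw [le_inv_comm₀ (by norm_num) hε]; linarith
          linarith [Real.exp_one_lt_d9]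
        have habs : |Real.log ε| = Real.log ε⁻¹ := by
          rw [Real.log_inv, abs_of_nonpos]
          rw [Real.log_inv] at hlog; linarith
        have hδl : 0 ≤ Real.log δ⁻¹ := Real.log_nonneg ((one_le_inv₀ hδ).2 hδ1)
        rw [habs, hη, mul_inv, Real.log_mul (by positivity) (by positivity)]
        nlinarith [mul_nonneg hA0 (sub_nonneg.2 hlog), mul_nonneg (mul_nonneg hB0.le hδl)
          (sub_nonneg.2 hlog)]

end SurfaceKernel

/-! ### Rays that avoid the thin tube. -/

section Directions

variable {X e₁ e₂ : ℝ → E3} {κmax cΓ : ℝ}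

/-- The point stays within `4 ε - η` of the center of the tangent ball of radius `4 ε`, whose
interior the curve avoids. -/
theorem HasReach.lt_norm_of_tangent_cone {ε η : ℝ} (h : HasReach X (4 * ε))
    (hηε : η ≤ ε) {s : ℝ} {e : E3} (he : IsUnitNormal X s e) {z : E3} (hz0 : 0 < ‖z‖)
    (hz : ‖z‖ < 3 * ε) (hez : ‖z‖ / 2 ≤ inner ℝ e z) (t : ℝ) :
    η < ‖X s + η • e + z - X t‖ := by
  have hε : 0 < ε := by linarith
  have h1 : ‖X s + η • e + z - (X s + (4 * ε) • e)‖ < 4 * ε - η := by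
    refine lt_of_pow_lt_pow_left₀ 2 (by linarith) ?_
    rw [show X s + η • e + z - (X s + (4 * ε) • e) = z - (4 * ε - η) • e by module,
      @norm_sub_sq ℝ, norm_smul, he.1, Real.norm_of_nonneg (by linarith), inner_smul_right,
      real_inner_comm]
    simp only [RCLike.re_to_real]
    nlinarith [mul_le_mul_of_nonneg_left hez (show 0 ≤ 4 * ε - η by linarith),
      mul_pos hz0 (show 0 < 4 * ε - η - ‖z‖ by linarith)]
  have h2 := IsCenterline.infDist_le (X := X) (X s + (4 * ε) • e) t
  rw [h.infDist_eq he (by linarith) le_rfl] at h2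
  have h3 := norm_sub_le_norm_sub_add_norm_sub (X s + (4 * ε) • e) (X s + η • e + z) (X t)
  rw [norm_sub_rev (X s + (4 * ε) • e) (X s + η • e + z)] at h3
  linarith

theorem half_norm_le_inner_of_mem_ball {e w : E3} (he : ‖e‖ = 1)
    (hw : w ∈ Metric.ball ((3 / 2 : ℝ) • e) (1 / 4)) :
    1 ≤ ‖w‖ ∧ ‖w‖ ≤ 2 ∧ ‖w‖ / 2 ≤ inner ℝ e w := by
  rw [mem_ball_iff_norm] at hw
  have h1 : ‖(3 / 2 : ℝ) • e‖ = 3 / 2 := by rw [norm_smul, he]; norm_num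
  have h2 := abs_norm_sub_norm_le w ((3 / 2 : ℝ) • e)
  rw [h1, abs_le] at h2
  have h3 := abs_real_inner_le_norm e (w - (3 / 2 : ℝ) • e)
  rw [inner_sub_right, inner_smul_right, real_inner_self_eq_norm_sq, he, abs_le] at h3
  refine ⟨by linarith, by linarith, by linarith [h3.1]⟩

/-- The length of the part of the curve at distance at most `3 η` from `y`. -/
noncomputable def nearbyLength (X : ℝ → E3) (η : ℝ) (y : E3) : ℝ≥0∞ :=
  ∫⁻ t in Ico (0 : ℝ) 1, {q : E3 × ℝ | ‖q.1 - X q.2‖ ≤ 3 * η}.indicator 1 (y, t)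

theorem measurableSet_nearby (hX : IsCenterline κmax cΓ X) (η : ℝ) :
    MeasurableSet {q : E3 × ℝ | ‖q.1 - X q.2‖ ≤ 3 * η} := by
  have := hX.differentiable.continuous
  exact (isClosed_le (by fun_prop) continuous_const).measurableSet

theorem measurable_nearbyLength (hX : IsCenterline κmax cΓ X) (η : ℝ) :
    Measurable (nearbyLength X η) :=
  ((measurable_one.indicator (measurableSet_nearby hX η))).lintegral_prod_right'

theorem le_nearbyLength (hX : IsCenterline κmax cΓ X) {η : ℝ} (hη1 : η ≤ 1) {y : E3}
    {t₀ : ℝ} (h : ‖y - X t₀‖ ≤ 2 * η) : ENNReal.ofReal η ≤ nearbyLength X η y := by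
  have hper : Function.Periodic
      (fun t => {q : E3 × ℝ | ‖q.1 - X q.2‖ ≤ 3 * η}.indicator (1 : E3 × ℝ → ℝ≥0∞) (y, t)) 1 := by
    intro t
    simp only [indicator, mem_ofPred_eq, hX.periodic t, Pi.one_apply]
  have h1 := setLIntegral_Ioc_periodic one_pos hper 0 t₀
  rw [zero_add] at h1
  rw [nearbyLength, restrict_Ico_eq_restrict_Ioc, h1]
  calc ENNReal.ofReal η = ∫⁻ _ in Ioc t₀ (t₀ + η), 1 := by simp
    _ ≤ ∫⁻ t in Ioc t₀ (t₀ + η),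
        {q : E3 × ℝ | ‖q.1 - X q.2‖ ≤ 3 * η}.indicator (1 : E3 × ℝ → ℝ≥0∞) (y, t) := by
      refine setLIntegral_mono' measurableSet_Ioc fun t ht => ?_
      rw [indicator_of_mem, Pi.one_apply]
      have h2 := hX.lipschitz t₀ t
      rw [abs_sub_comm, abs_of_pos (by linarith [ht.1])] at h2
      have h3 := norm_sub_le_norm_sub_add_norm_sub y (X t₀) (X t)
      simp only [mem_ofPred_eq]
      linarith [ht.2]
    _ ≤ _ := lintegral_mono_set (Ioc_subset_Ioc_right (by linarith))

/-- The density, seen from `x₀`, of the part of the curve at distance at least `3 ε`. -/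
noncomputable def obstruction (X : ℝ → E3) (ε η : ℝ) (x₀ y : E3) : ℝ≥0∞ :=
  {y : E3 | 3 * ε ≤ ‖y - x₀‖}.indicator (fun y => (‖y - x₀‖ₑ ^ 2)⁻¹ * nearbyLength X η y) y

theorem measurable_obstruction (hX : IsCenterline κmax cΓ X) (ε η : ℝ) (x₀ : E3) :
    Measurable (obstruction X ε η x₀) := by
  have := measurable_nearbyLength hX η
  exact Measurable.indicator (by fun_prop) (measurableSet_le (by fun_prop) (by fun_prop))

/-- After exchanging integrals, each `t` contributes a ball of volume of order `27 η³` times a bound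
for `‖y - x₀‖⁻²`. There `ε ≤ ‖y - x₀‖ / 3` and `cΓ τ ≤ 3 ‖y - x₀‖`, so this bound is `10 / (ε² + (cΓ
τ)²)`, whose integral in `τ` is at most `10 π / (cΓ ε)`. -/
theorem lintegral_obstruction_le (hX : IsCenterline κmax cΓ X) (hcΓ : 0 < cΓ) {ε η : ℝ}
    (hη : 0 < η) (hηε : η ≤ ε) {s : ℝ} {x₀ : E3} (hx₀ : ‖x₀ - X s‖ ≤ η) :
    ∫⁻ y, obstruction X ε η x₀ y ≤ ENNReal.ofReal (270 * η ^ 3 * (Real.pi / (cΓ * ε))) *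
      volume (Metric.ball (0 : E3) 1) := by
  have hε : 0 < ε := hη.trans_le hηε
  have hpi := Real.pi_pos
  let N : Set (E3 × ℝ) := {q : E3 × ℝ | ‖q.1 - X q.2‖ ≤ 3 * η}
  have hN : MeasurableSet N := measurableSet_nearby hX η
  let S : Set E3 := {y : E3 | 3 * ε ≤ ‖y - x₀‖}
  have hS : MeasurableSet S := measurableSet_le (by fun_prop) (by fun_prop)
  have hobs : ∀ y, obstruction X ε η x₀ y = ∫⁻ t in Ico (0 : ℝ) 1,
      S.indicator (fun y => (‖y - x₀‖ₑ ^ 2)⁻¹) y * N.indicator 1 (y, t) := by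
    intro y
    have hNy : Measurable fun t => N.indicator (1 : E3 × ℝ → ℝ≥0∞) (y, t) :=
      (measurable_one.indicator hN).comp measurable_prodMk_left
    rw [lintegral_const_mul _ hNy]
    simp only [obstruction, nearbyLength, indicator]
    split_ifs <;> simp_all [S, N, indicator]
  have hm : Measurable fun q : E3 × ℝ =>
      S.indicator (fun y => (‖y - x₀‖ₑ ^ 2)⁻¹) q.1 * N.indicator 1 (q.1, q.2) :=
    ((Measurable.indicator (by fun_prop) hS).comp measurable_fst).mul
      (measurable_one.indicator hN)
  simp_rw [hobs]
  rw [lintegral_lintegral_swap hm.aemeasurable]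
  have hvol : ∀ t, volume (Metric.closedBall (X t) (3 * η)) =
      ENNReal.ofReal (27 * η ^ 3) * volume (Metric.ball (0 : E3) 1) := by
    intro t
    rw [Measure.addHaar_closedBall _ _ (by positivity), finrank_euclideanSpace_fin]
    ring_nf
  calc _ ≤ ∫⁻ t in Ico (0 : ℝ) 1, ENNReal.ofReal (270 * η ^ 3) * volume (Metric.ball (0 : E3) 1) *
        ENNReal.ofReal ((ε ^ 2 + (cΓ * ‖((s - t : ℝ) : UnitAddCircle)‖) ^ 2)⁻¹) := by
        refine lintegral_mono fun t => ?_
        set τ := ‖((s - t : ℝ) : UnitAddCircle)‖ with hτ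
        have hpt : ∀ y, S.indicator (fun y => (‖y - x₀‖ₑ ^ 2)⁻¹) y * N.indicator 1 (y, t) ≤
            (Metric.closedBall (X t) (3 * η)).indicator
              (fun _ => ENNReal.ofReal (10 * (ε ^ 2 + (cΓ * τ) ^ 2)⁻¹)) y := by
          intro y
          by_cases hyS : y ∈ S
          · by_cases hyN : (y, t) ∈ N
            · rw [indicator_of_mem hyS, indicator_of_mem hyN, Pi.one_apply, mul_one,
                indicator_of_mem (by rw [mem_closedBall_iff_norm]; exact hyN)]
              have hyS : 3 * ε ≤ ‖y - x₀‖ := hyS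
              have hyN : ‖y - X t‖ ≤ 3 * η := hyN
              have hnon := hX.non_intersecting s t
              rw [← hτ] at hnon
              have h1 := norm_sub_le_norm_sub_add_norm_sub (X s) x₀ (X t)
              have h2 := norm_sub_le_norm_sub_add_norm_sub x₀ y (X t)
              rw [norm_sub_rev] at hx₀
              rw [norm_sub_rev x₀ y] at h2
              have h3 : cΓ * τ ≤ 3 * ‖y - x₀‖ := by linarith
              have h0 : 0 ≤ cΓ * τ := by positivity
              have hpos : 0 < ‖y - x₀‖ := by linarith
              rw [← ofReal_norm, ← ENNReal.ofReal_pow hpos.le, ← ENNReal.ofReal_inv_of_pos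
                (by positivity)]
              refine ENNReal.ofReal_le_ofReal ?_
              rw [← div_eq_mul_inv, inv_eq_one_div, div_le_div_iff₀ (by positivity) (by positivity)]
              nlinarith
            · rw [indicator_of_notMem hyN, mul_zero]; exact zero_le
          · rw [indicator_of_notMem hyS, zero_mul]; exact zero_le
        refine (lintegral_mono hpt).trans ?_
        rw [lintegral_indicator measurableSet_closedBall, setLIntegral_const, hvol,
          ← mul_assoc, ← ENNReal.ofReal_mul (by positivity), mul_right_comm _ (volume _),
          ← ENNReal.ofReal_mul (by positivity)]
        gcongr ENNReal.ofReal ?_ * _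
        apply le_of_eq
        ring
    _ ≤ ENNReal.ofReal (270 * η ^ 3) * volume (Metric.ball (0 : E3) 1) *
        ENNReal.ofReal (Real.pi / (cΓ * ε)) := by
        rw [lintegral_const_mul' _ _ (by finiteness),
          setLIntegral_norm_circle fun τ => ENNReal.ofReal ((ε ^ 2 + (cΓ * τ) ^ 2)⁻¹)]
        gcongr
        exact lintegral_inv_add_sq_le hε hcΓ _ (by norm_num)
    _ = _ := by
        rw [mul_right_comm, ← ENNReal.ofReal_mul (by positivity)]

/-- A ray that meets the `η`-tube beyond distance `3 ε` remains within `2 η` of a point of the curve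
for a parameter length `η / 2`. There `nearbyLength` is at least `η` and the weight `l² / ‖l w‖²` at
least `1/4`. -/
theorem le_lintegral_ray_obstruction (hX : IsCenterline κmax cΓ X) {ε η : ℝ} (hη : 0 < η)
    (hη1 : η ≤ 1) {x₀ w : E3} (hw1 : 1 ≤ ‖w‖) (hw2 : ‖w‖ ≤ 2) {l₀ : ℝ} (hl₀ : 0 < l₀)
    (hl : 3 * ε ≤ l₀ * ‖w‖) (hd : Metric.infDist (x₀ + l₀ • w) (range X) ≤ η) :
    ENNReal.ofReal (η ^ 2 / 8) ≤
      ∫⁻ l in Ioi (0 : ℝ), ENNReal.ofReal (l ^ 2) * obstruction X ε η x₀ (x₀ + l • w) := by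
  obtain ⟨t₀, ht₀⟩ := hX.exists_nearest (x₀ + l₀ • w)
  rw [ht₀] at hd
  calc ENNReal.ofReal (η ^ 2 / 8) = ∫⁻ _ in Icc l₀ (l₀ + η / 2), ENNReal.ofReal (η / 4) := by
        rw [setLIntegral_const, Real.volume_Icc, ← ENNReal.ofReal_mul (by positivity)]
        ring_nf
    _ ≤ ∫⁻ l in Icc l₀ (l₀ + η / 2), ENNReal.ofReal (l ^ 2) * obstruction X ε η x₀ (x₀ + l • w) := by
        refine setLIntegral_mono' measurableSet_Icc fun l hl' => ?_
        have hl0 : 0 < l := hl₀.trans_le hl'.1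
        have hnorm : ‖x₀ + l • w - x₀‖ = l * ‖w‖ := by
          rw [add_sub_cancel_left, norm_smul, Real.norm_of_nonneg hl0.le]
        have hmem : x₀ + l • w ∈ {y : E3 | 3 * ε ≤ ‖y - x₀‖} := by
          show 3 * ε ≤ ‖x₀ + l • w - x₀‖
          rw [hnorm]
          exact hl.trans (by gcongr; exact hl'.1)
        have hclose : ‖x₀ + l • w - X t₀‖ ≤ 2 * η := by
          have h1 : x₀ + l • w - X t₀ = (x₀ + l₀ • w - X t₀) + (l - l₀) • w := by module
          rw [h1]
          refine (norm_add_le _ _).trans ?_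
          rw [norm_smul, Real.norm_of_nonneg (sub_nonneg.2 hl'.1)]
          have : (l - l₀) * ‖w‖ ≤ η / 2 * 2 :=
            mul_le_mul (by linarith [hl'.2]) hw2 (norm_nonneg _) (by linarith)
          linarith
        rw [obstruction, indicator_of_mem hmem, ← ofReal_norm, hnorm,
          ← ENNReal.ofReal_pow (by positivity), ← ENNReal.ofReal_inv_of_pos (by positivity),
          ← mul_assoc, ← ENNReal.ofReal_mul (by positivity)]
        calc ENNReal.ofReal (η / 4) = ENNReal.ofReal (1 / 4) * ENNReal.ofReal η := by
              rw [← ENNReal.ofReal_mul (by norm_num)]; ring_nf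
          _ ≤ _ := by
            gcongr
            · rw [mul_pow, mul_inv, ← mul_assoc, mul_inv_cancel₀ (by positivity), one_mul, one_div]
              refine inv_anti₀ (by positivity) ?_
              nlinarith
            · exact le_nearbyLength hX hη1 hclose
    _ ≤ _ := lintegral_mono_set fun l hl' => hl₀.trans_le hl'.1

/-- From a point at distance `δ ε` of a curve of reach `4 ε`, most rays in a cone about the normal
direction stay at distance more than `δ ε` from the curve. -/
theorem exists_directions (cΓ : ℝ) (hcΓ : 0 < cΓ) :
    ∃ δ : ℝ, 0 < δ ∧ δ ≤ 1 ∧ ∃ a : ℝ≥0∞, a ≠ 0 ∧ a ≠ ⊤ ∧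
      ∀ (κmax : ℝ) (X : ℝ → E3) (ε : ℝ), IsCenterline κmax cΓ X → 0 < ε → HasReach X (4 * ε) →
      ∀ s e, IsUnitNormal X s e →
      ∃ W ⊆ {w : E3 | 1 ≤ ‖w‖ ∧ ‖w‖ ≤ 2}, MeasurableSet W ∧ a ≤ volume W ∧
        ∀ w ∈ W, ∀ l : ℝ, 0 < l →
          δ * ε < Metric.infDist (X s + (δ * ε) • e + l • w) (range X) := by
  have hpi := Real.pi_pos
  set V := volume (Metric.ball (0 : E3) 1) with hV
  have hV0 : V ≠ 0 := (Metric.measure_ball_pos volume _ one_pos).ne'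
  have hVt : V ≠ ⊤ := measure_ball_lt_top.ne
  -- Here `276480 = 270 · 8 · 128`: by Markov's inequality the blocked directions have volume at
  -- most `V / 128`, half that of the ball `b` of directions, which is `V / 64`.
  set δ := min 1 (cΓ / (276480 * Real.pi)) with hδ
  have hδ0 : 0 < δ := lt_min one_pos (by positivity)
  have hδ1 : δ ≤ 1 := min_le_left _ _
  refine ⟨δ, hδ0, hδ1, ENNReal.ofReal (1 / 128) * V, ?_, by finiteness, ?_⟩
  · simp [hV0]
  intro κmax X ε hX hε hR s e he
  have hε8 : ε ≤ 1 / 8 := by have := hR.one_ge hX hcΓ; linarith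
  set η := δ * ε with hη
  have hη0 : 0 < η := by positivity
  have hηε : η ≤ ε := by nlinarith
  set x₀ := X s + η • e with hx₀
  have hx₀s : ‖x₀ - X s‖ ≤ η := by
    rw [hx₀, add_sub_cancel_left, norm_smul, he.1, mul_one, Real.norm_of_nonneg hη0.le]
  set I : E3 → ℝ≥0∞ := fun w =>
    ∫⁻ l in Ioi (0 : ℝ), ENNReal.ofReal (l ^ 2) * obstruction X ε η x₀ (x₀ + l • w) with hI
  have hobs := measurable_obstruction hX ε η x₀
  have hIm : Measurable I := by
    refine Measurable.lintegral_prod_right' (f := fun p : E3 × ℝ =>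
      ENNReal.ofReal (p.2 ^ 2) * obstruction X ε η x₀ (x₀ + p.2 • p.1)) ?_
    fun_prop
  set A : Set E3 := {w : E3 | 1 ≤ ‖w‖ ∧ ‖w‖ ≤ 2} with hA
  set b := Metric.ball ((3 / 2 : ℝ) • e) (1 / 4) with hb
  set bad : Set E3 := {w | ENNReal.ofReal (η ^ 2 / 8) ≤ I w} with hbad
  have hbadm : MeasurableSet bad := measurableSet_le measurable_const hIm
  have hbA : b ⊆ A := fun w hw =>
    ⟨(half_norm_le_inner_of_mem_ball he.1 hw).1, (half_norm_le_inner_of_mem_ball he.1 hw).2.1⟩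
  refine ⟨b \ bad, sdiff_subset.trans hbA, Metric.isOpen_ball.measurableSet.diff hbadm, ?_, ?_⟩
  · have hbvol : volume b = ENNReal.ofReal (1 / 64) * V := by
      rw [hb, Measure.addHaar_ball _ _ (by norm_num), finrank_euclideanSpace_fin]
      norm_num [hV]
    have hAm : MeasurableSet A :=
      (measurableSet_le measurable_const measurable_norm).inter
        (measurableSet_le measurable_norm measurable_const)
    have hη8 : ENNReal.ofReal (η ^ 2 / 8) ≠ 0 := by
      simp only [ne_eq, ENNReal.ofReal_eq_zero, not_le]; positivity
    have hmarkov : ENNReal.ofReal (η ^ 2 / 8) * volume (bad ∩ A) ≤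
        ENNReal.ofReal (270 * η ^ 3 * (Real.pi / (cΓ * ε))) * V := by
      have h1 := mul_meas_ge_le_lintegral (μ := volume.restrict A) hIm (ENNReal.ofReal (η ^ 2 / 8))
      rw [Measure.restrict_apply' hAm] at h1
      exact (h1.trans (lintegral_rays_le hobs x₀)).trans
        (lintegral_obstruction_le hX hcΓ hη0 hηε hx₀s)
    have hbadvol : volume (bad ∩ A) ≤ ENNReal.ofReal (1 / 128) * V := by
      rw [← ENNReal.mul_le_mul_iff_right hη8 ENNReal.ofReal_ne_top]
      refine hmarkov.trans ?_
      rw [← mul_assoc, ← ENNReal.ofReal_mul (by positivity)]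
      gcongr ENNReal.ofReal ?_ * _
      have hδc : δ * (276480 * Real.pi) ≤ cΓ := by
        rw [← le_div_iff₀ (by positivity)]; exact min_le_right _ _
      rw [show 270 * η ^ 3 * (Real.pi / (cΓ * ε)) = 270 * η ^ 2 * (δ * Real.pi / cΓ) by
        rw [hη]; field_simp]
      have : δ * Real.pi / cΓ ≤ 1 / 276480 := by
        rw [div_le_div_iff₀ hcΓ (by norm_num)]; linarith
      nlinarith [mul_le_mul_of_nonneg_left this (show 0 ≤ 270 * η ^ 2 by positivity)]
    have h2 : volume b ≤ volume (b \ bad) + volume (bad ∩ A) := by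
      refine (measure_mono ?_).trans (measure_union_le _ _)
      intro w hw
      by_cases hwb : w ∈ bad
      · exact Or.inr ⟨hwb, hbA hw⟩
      · exact Or.inl ⟨hw, hwb⟩
    have h3 : volume b = ENNReal.ofReal (1 / 128) * V + ENNReal.ofReal (1 / 128) * V := by
      rw [hbvol, ← add_mul, ← ENNReal.ofReal_add (by norm_num) (by norm_num)]
      norm_num
    rw [h3] at h2
    exact ENNReal.le_of_add_le_add_right (by finiteness) (h2.trans (by gcongr))
  · rintro w ⟨hwb, hwbad⟩ l hl
    obtain ⟨hw1, hw2, hew⟩ := half_norm_le_inner_of_mem_ball he.1 hwb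
    have hnorm : ‖l • w‖ = l * ‖w‖ := by rw [norm_smul, Real.norm_of_nonneg hl.le]
    by_cases hfar : 3 * ε ≤ l * ‖w‖
    · by_contra! hle
      exact hwbad (le_lintegral_ray_obstruction hX hη0 (by linarith) hw1 hw2 hl hfar hle)
    · obtain ⟨t, ht⟩ := hX.exists_nearest (x₀ + l • w)
      rw [ht]
      refine hR.lt_norm_of_tangent_cone hηε he ?_ ?_ ?_ t
      · rw [hnorm]; positivity
      · rw [hnorm]; exact not_le.1 hfar
      · rw [hnorm, inner_smul_right]
        nlinarith

end Directions

/-! ### The field on the surface is bounded by a potential of its gradient. -/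

section PointwiseBound

variable {X e₁ e₂ : ℝ → E3} {κmax cΓ : ℝ}

/-- The set of points at distance more than `r` from the curve. -/
def outside (X : ℝ → E3) (r : ℝ) : Set E3 := {x | r < Metric.infDist x (range X)}

theorem isOpen_outside (X : ℝ → E3) (r : ℝ) : IsOpen (outside X r) :=
  isOpen_lt continuous_const (Metric.continuous_infDist_pt _)

theorem measurable_indicator_of_continuousOn {E : Type*} [TopologicalSpace E] [MeasurableSpace E]
    [OpensMeasurableSpace E] {s : Set E} (hs : MeasurableSet s)
    {f : E → ℝ≥0∞} (hf : ContinuousOn f s) : Measurable (s.indicator f) := by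
  classical
  rw [← piecewise_eq_indicator]
  exact hf.measurable_piecewise continuousOn_const hs

/-- The norm of the gradient of `v`, pulled back along `Φ` and cut off. -/
noncomputable def pulledGrad (X : ℝ → E3) (η : ℝ) (Φ v : E3 → E3) : E3 → ℝ≥0∞ :=
  (outside X η).indicator fun y => ‖fderiv ℝ v (Φ y)‖ₑ

variable {ε η : ℝ} {Φ v : E3 → E3}

theorem IsBlowUp.mapsTo_outside (hΦ : IsBlowUp X ε η Φ) (h : HasReach X (4 * ε)) (hη : 0 < η)
    (hηε : η ≤ ε) : MapsTo Φ (outside X η) (outside X ε) :=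
  fun _ hx => hΦ.infDist_gt h hη hηε hx

theorem IsBlowUp.continuousOn_fderiv_comp (hΦ : IsBlowUp X ε η Φ) (h : HasReach X (4 * ε))
    (hη : 0 < η) (hηε : η ≤ ε) (hv : ContDiffOn ℝ 1 v (outside X ε)) :
    ContinuousOn (fun y => fderiv ℝ v (Φ y)) (outside X η) := by
  refine (hv.continuousOn_fderiv_of_isOpen (isOpen_outside X ε) le_rfl).comp ?_
    (hΦ.mapsTo_outside h hη hηε)
  exact fun x hx => (hΦ.continuousAt h hη hηε (le_of_lt hx)).continuousWithinAt

theorem measurable_pulledGrad (hΦ : IsBlowUp X ε η Φ) (h : HasReach X (4 * ε))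
    (hη : 0 < η) (hηε : η ≤ ε) (hv : ContDiffOn ℝ 1 v (outside X ε)) :
    Measurable (pulledGrad X η Φ v) :=
  measurable_indicator_of_continuousOn (isOpen_outside X η).measurableSet
    (hΦ.continuousOn_fderiv_comp h hη hηε hv).enorm

/-- The chain rule as a slope bound, for a path that is only Lipschitz at `l`. -/
theorem eventually_norm_comp_sub_le {E F : Type*} [NormedAddCommGroup E] [NormedSpace ℝ E]
    [NormedAddCommGroup F] [NormedSpace ℝ F] {v : E → F} {γ : ℝ → E} {l C r : ℝ} (hC : 0 < C)
    (hv : DifferentiableAt ℝ v (γ l)) (hγ : ∀ᶠ z in 𝓝 l, ‖γ z - γ l‖ ≤ C * ‖z - l‖)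
    (hr : C * ‖fderiv ℝ v (γ l)‖ < r) :
    ∀ᶠ z in 𝓝 l, ‖v (γ z) - v (γ l)‖ ≤ r * ‖z - l‖ := by
  have hc : 0 < r / C - ‖fderiv ℝ v (γ l)‖ := by
    rw [sub_pos, lt_div_iff₀ hC]; linarith
  have h1 := hv.hasFDerivAt.isLittleO.def hc
  have hcont : ContinuousAt γ l := continuousAt_of_eventually_norm_sub_le hγ
  filter_upwards [hcont.eventually h1, hγ] with z hz1 hz2
  have h2 := (fderiv ℝ v (γ l)).le_opNorm (γ z - γ l)
  have h3 := norm_sub_norm_le (v (γ z) - v (γ l)) (fderiv ℝ v (γ l) (γ z - γ l))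
  have h4 : ‖v (γ z) - v (γ l)‖ ≤ r / C * ‖γ z - γ l‖ := by linarith
  have hrC : 0 ≤ r / C := by linarith [norm_nonneg (fderiv ℝ v (γ l))]
  calc _ ≤ r / C * (C * ‖z - l‖) := h4.trans (by gcongr)
    _ = _ := by field_simp

/-- The increments of `v ∘ Φ` along a ray that stays outside the tube of radius `η`. -/
theorem enorm_sub_le_of_ray (hΦ : IsBlowUp X ε η Φ) (h : HasReach X (4 * ε))
    (hη : 0 < η) (hηε : η ≤ ε) (hv : ContDiffOn ℝ 1 v (outside X ε)) {x w : E3} (hw : ‖w‖ ≤ 2)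
    (hray : ∀ l : ℝ, 0 < l → x + l • w ∈ outside X η) {a b : ℝ} (ha : 0 < a) (hab : a ≤ b) :
    ‖v (Φ (x + b • w)) - v (Φ (x + a • w))‖ₑ ≤ ENNReal.ofReal (2 * (5 + 18 * (ε / η))) *
      ∫⁻ l in Ioi (0 : ℝ), pulledGrad X η Φ v (x + l • w) := by
  have hε : 0 < ε := hη.trans_le hηε
  have hL : 0 < 2 * (5 + 18 * (ε / η)) := by positivity
  set L := 5 + 18 * (ε / η) with hLdef
  have hsub : Icc a b ⊆ Ioi (0 : ℝ) := fun l hl => ha.trans_le hl.1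
  have hgc : ContinuousOn (fun l : ℝ => 2 * L * ‖fderiv ℝ v (Φ (x + l • w))‖) (Ioi 0) := by
    refine continuousOn_const.mul (ContinuousOn.norm ?_)
    exact (hΦ.continuousOn_fderiv_comp h hη hηε hv).comp (by fun_prop) fun l hl => hray l hl
  have h1 := enorm_sub_le_lintegral_of_slope (f := fun l : ℝ => v (Φ (x + l • w))) hab isOpen_Ioi
    hsub hgc (fun l => by positivity) ?_
  · refine h1.trans ?_
    have h2 : ∀ l ∈ Icc a b, ENNReal.ofReal (2 * L * ‖fderiv ℝ v (Φ (x + l • w))‖) =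
        ENNReal.ofReal (2 * L) * pulledGrad X η Φ v (x + l • w) := by
      intro l hl
      rw [pulledGrad, indicator_of_mem (hray l (hsub hl)), ENNReal.ofReal_mul hL.le, ofReal_norm]
    rw [setLIntegral_congr_fun measurableSet_Icc h2, lintegral_const_mul' _ _ ENNReal.ofReal_ne_top]
    gcongr
  · intro l hl r hr
    have hlU := hray l (hsub hl)
    have hΦU := hΦ.mapsTo_outside h hη hηε hlU
    have hdiff : DifferentiableAt ℝ v (Φ (x + l • w)) :=
      (hv.differentiableOn one_ne_zero).differentiableAt ((isOpen_outside X ε).mem_nhds hΦU)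
    refine eventually_norm_comp_sub_le (γ := fun l : ℝ => Φ (x + l • w)) hL hdiff ?_ hr
    have hc : ContinuousAt (fun l : ℝ => x + l • w) l := by fun_prop
    filter_upwards [hc.eventually (hΦ.eventually_lipschitz h hη hηε (le_of_lt hlU))] with z hz
    refine hz.trans ?_
    rw [← hLdef, show x + z • w - (x + l • w) = (z - l) • w by module, norm_smul]
    have : 0 ≤ L * ‖z - l‖ := by positivity
    nlinarith

/-- The starting parameter tends to `0`: `Φ` carries the base point of the ray to `X s + ε e`, and
`v` is continuous up to the closure. -/
theorem enorm_sub_surface_le_of_ray (hΦ : IsBlowUp X ε η Φ) (h : HasReach X (4 * ε))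
    (hη : 0 < η) (hηε : η ≤ ε) (hv : ContDiffOn ℝ 1 v (outside X ε))
    (hvc : ContinuousOn v (closure (outside X ε))) {s : ℝ} {e w : E3} (he : IsUnitNormal X s e)
    (hw : ‖w‖ ≤ 2) (hray : ∀ l : ℝ, 0 < l → X s + η • e + l • w ∈ outside X η) {b : ℝ}
    (hb : 0 < b) :
    ‖v (Φ (X s + η • e + b • w)) - v (X s + ε • e)‖ₑ ≤ ENNReal.ofReal (2 * (5 + 18 * (ε / η))) *
      ∫⁻ l in Ioi (0 : ℝ), pulledGrad X η Φ v (X s + η • e + l • w) := by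
  set x := X s + η • e with hx
  have hdx : Metric.infDist x (range X) = η := h.infDist_eq he hη.le (by linarith)
  have hγ : Tendsto (fun l : ℝ => Φ (x + l • w)) (𝓝[>] 0) (𝓝 (X s + ε • e)) := by
    have h1 : ContinuousAt (fun l : ℝ => x + l • w) 0 := by fun_prop
    have h2 : ContinuousAt Φ (x + (0 : ℝ) • w) := by
      rw [zero_smul, add_zero]; exact hΦ.continuousAt h hη hηε hdx.ge
    have h3 := (ContinuousAt.comp (f := fun l : ℝ => x + l • w) h2 h1).tendsto
    simp only [Function.comp_def, zero_smul, add_zero] at h3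
    rw [hx, hΦ.apply_surface h hη hηε he, ← hx] at h3
    exact h3.mono_left nhdsWithin_le_nhds
  have hmem : ∀ᶠ l : ℝ in 𝓝[>] 0, Φ (x + l • w) ∈ outside X ε := by
    filter_upwards [self_mem_nhdsWithin] with l hl using hΦ.mapsTo_outside h hη hηε (hray l hl)
  have hcl : X s + ε • e ∈ closure (outside X ε) := mem_closure_of_tendsto hγ hmem
  have hlim : Tendsto (fun l : ℝ => v (Φ (x + l • w))) (𝓝[>] 0) (𝓝 (v (X s + ε • e))) :=
    (hvc _ hcl).tendsto.comp (tendsto_nhdsWithin_iff.2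
      ⟨hγ, hmem.mono fun _ hl => subset_closure hl⟩)
  have hlim2 := ((tendsto_const_nhds (x := v (Φ (x + b • w)))).sub hlim).enorm
  refine le_of_tendsto hlim2 ?_
  filter_upwards [Ioc_mem_nhdsGT hb] with a ha
  exact enorm_sub_le_of_ray hΦ h hη hηε hv hw hray ha.1 ha.2

/-- This stands in for decay at infinity: applied to `‖v‖⁶` along a ray, it excludes a positive
lower bound. -/
theorem eq_zero_of_forall_le_of_lintegral_lt_top {f : ℝ → ℝ≥0∞} {c : ℝ≥0∞} {b : ℝ} (hb : 1 ≤ b)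
    (hf : ∫⁻ l in Ioi (0 : ℝ), ENNReal.ofReal (l ^ 2) * f l < ⊤) (hc : ∀ l, b ≤ l → c ≤ f l) :
    c = 0 := by
  by_contra h0
  refine hf.ne (top_unique ?_)
  calc ⊤ = ∫⁻ _ in Ici b, c := by simp [h0]
    _ ≤ ∫⁻ l in Ici b, ENNReal.ofReal (l ^ 2) * f l := by
      refine setLIntegral_mono' measurableSet_Ici fun l hl => ?_
      have hl : b ≤ l := hl
      refine (hc l hl).trans (le_mul_of_one_le_left zero_le ?_)
      rw [ENNReal.one_le_ofReal]
      nlinarith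
    _ ≤ _ := lintegral_mono_set fun l hl => zero_lt_one.trans_le (hb.trans hl)

theorem IsCenterline.exists_infDist_ray_ge (hX : IsCenterline κmax cΓ X) (x : E3) (r : ℝ) :
    ∃ b : ℝ, 1 ≤ b ∧ ∀ w : E3, 1 ≤ ‖w‖ → ∀ l, b ≤ l →
      r ≤ Metric.infDist (x + l • w) (range X) := by
  obtain ⟨R, hR⟩ := hX.isCompact_range.isBounded.exists_norm_le
  refine ⟨max 1 (‖x‖ + R + r), le_max_left _ _, fun w hw l hl => ?_⟩
  refine (Metric.le_infDist (range_nonempty X)).2 ?_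
  intro y hy
  have h1 := hR y hy
  have h2 : 1 ≤ l := (le_max_left _ _).trans hl
  have h3 : ‖x‖ + R + r ≤ l := (le_max_right _ _).trans hl
  have h4 : l ≤ ‖l • w‖ := by
    rw [norm_smul, Real.norm_of_nonneg (by linarith)]; nlinarith
  have h5 : ‖l • w‖ ≤ ‖x + l • w - y‖ + ‖x‖ + ‖y‖ := by
    calc ‖l • w‖ = ‖(x + l • w - y) - x + y‖ := by congr 1; abel
      _ ≤ _ := (norm_add_le _ _).trans (by gcongr; exact norm_sub_le _ _)
  rw [dist_eq_norm]
  linarith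

/-- The ray estimate is averaged over the free directions, of volume at least `a`. Since `4 l² / ‖l
w‖² ≥ 1`, the weight `l²` and the kernel can be inserted, and `lintegral_rays_le` turns the average
into a volume integral. -/
theorem exists_pointwise_bound (cΓ : ℝ) (hcΓ : 0 < cΓ) :
    ∃ δ : ℝ, 0 < δ ∧ δ ≤ 1 ∧ ∃ C : ℝ≥0∞, C ≠ ⊤ ∧
      ∀ (κmax : ℝ) (X : ℝ → E3) (ε : ℝ), IsCenterline κmax cΓ X → 0 < ε → HasReach X (4 * ε) →
      ∀ Φ, IsBlowUp X ε (δ * ε) Φ → ∀ v : E3 → E3, ContDiffOn ℝ 1 v (outside X ε) →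
      ContinuousOn v (closure (outside X ε)) → ∫⁻ y in outside X ε, ‖v y‖ₑ ^ 6 < ⊤ →
      ∀ s e, IsUnitNormal X s e → ‖v (X s + ε • e)‖ₑ ≤
        C * ∫⁻ y, pulledGrad X (δ * ε) Φ v y * (‖y - (X s + (δ * ε) • e)‖ₑ ^ 2)⁻¹ := by
  obtain ⟨δ, hδ0, hδ1, a, ha0, hat, hdir⟩ := exists_directions cΓ hcΓ
  refine ⟨δ, hδ0, hδ1, a⁻¹ * (ENNReal.ofReal (2 * (5 + 18 * δ⁻¹)) * 4), by finiteness, ?_⟩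
  intro κmax X ε hX hε hR Φ hΦ v hv hvc hv6 s e he
  obtain ⟨W, hWA, hWm, haW, hW⟩ := hdir κmax X ε hX hε hR s e he
  set η := δ * ε with hη
  have hη0 : 0 < η := by positivity
  have hηε : η ≤ ε := by nlinarith
  have hεη : ε / η = δ⁻¹ := by rw [hη]; field_simp
  set x := X s + η • e with hx
  set A : Set E3 := {w : E3 | 1 ≤ ‖w‖ ∧ ‖w‖ ≤ 2} with hA
  have hHm := measurable_pulledGrad hΦ hR hη0 hηε hv
  set H := pulledGrad X η Φ v with hH
  set L := ENNReal.ofReal (2 * (5 + 18 * δ⁻¹)) with hL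
  have hVm : Measurable ((outside X ε).indicator fun y => ‖v y‖ₑ ^ 6) := by
    refine measurable_indicator_of_continuousOn (isOpen_outside X ε).measurableSet ?_
    exact (ENNReal.continuous_pow 6).comp_continuousOn hv.continuousOn.enorm
  have hdecay : ∀ᵐ w ∂volume.restrict A, ∫⁻ l in Ioi (0 : ℝ), ENNReal.ofReal (l ^ 2) *
      (outside X ε).indicator (fun y => ‖v y‖ₑ ^ 6) (x + l • w) < ⊤ := by
    refine ae_lt_top ?_ (((lintegral_rays_le hVm x).trans_lt ?_).ne)
    · refine Measurable.lintegral_prod_right' (f := fun p : E3 × ℝ => ENNReal.ofReal (p.2 ^ 2) *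
        (outside X ε).indicator (fun y => ‖v y‖ₑ ^ 6) (x + p.2 • p.1)) ?_
      fun_prop
    · rwa [lintegral_indicator (isOpen_outside X ε).measurableSet]
  obtain ⟨b, hb1, hb⟩ := hX.exists_infDist_ray_ge x (2 * ε)
  have hray : ∀ᵐ w ∂volume.restrict W, ‖v (X s + ε • e)‖ₑ ≤
      L * ∫⁻ l in Ioi (0 : ℝ), H (x + l • w) := by
    filter_upwards [ae_restrict_mem hWm, ae_mono (Measure.restrict_mono hWA le_rfl) hdecay] with w
      hw hdec
    have hwA := hWA hw
    set Q := L * ∫⁻ l in Ioi (0 : ℝ), H (x + l • w) with hQ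
    -- The subtraction is truncated, so its vanishing means exactly that the surface value is at
    -- most `Q`.
    have h1 : ∀ l, b ≤ l → (‖v (X s + ε • e)‖ₑ - Q) ^ 6 ≤
        (outside X ε).indicator (fun y => ‖v y‖ₑ ^ 6) (x + l • w) := by
      intro l hl
      have h2 := enorm_sub_surface_le_of_ray hΦ hR hη0 hηε hv hvc he hwA.2 (hW w hw)
        (b := l) (by linarith)
      rw [hεη, ← hx, ← hL, ← hH, ← hQ] at h2
      have h3 := hb w hwA.1 l hl
      rw [hΦ.eq_self hη0.le h3] at h2
      have h4 : x + l • w ∈ outside X ε := by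
        show ε < Metric.infDist (x + l • w) (range X)
        linarith
      rw [indicator_of_mem h4]
      gcongr
      rw [tsub_le_iff_left]
      calc ‖v (X s + ε • e)‖ₑ = ‖v (x + l • w) - (v (x + l • w) - v (X s + ε • e))‖ₑ := by
            rw [sub_sub_cancel]
        _ ≤ ‖v (x + l • w)‖ₑ + Q := (enorm_sub_le).trans (by gcongr)
        _ = _ := add_comm _ _
    have h5 := eq_zero_of_forall_le_of_lintegral_lt_top hb1 hdec h1
    exact tsub_eq_zero_iff_le.1 (pow_eq_zero_iff (by norm_num) |>.1 h5)
  have hmain : a * ‖v (X s + ε • e)‖ₑ ≤ L * 4 * ∫⁻ y, H y * (‖y - x‖ₑ ^ 2)⁻¹ := by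
    calc a * ‖v (X s + ε • e)‖ₑ ≤ ∫⁻ _ in W, ‖v (X s + ε • e)‖ₑ := by
          rw [setLIntegral_const, mul_comm]; gcongr
      _ ≤ ∫⁻ w in W, L * ∫⁻ l in Ioi (0 : ℝ), H (x + l • w) := lintegral_mono_ae hray
      _ ≤ ∫⁻ w in A, L * ∫⁻ l in Ioi (0 : ℝ), H (x + l • w) := lintegral_mono_set hWA
      _ ≤ ∫⁻ w in A, L * (4 * ∫⁻ l in Ioi (0 : ℝ), ENNReal.ofReal (l ^ 2) *
          (H (x + l • w) * (‖x + l • w - x‖ₑ ^ 2)⁻¹)) := by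
          refine setLIntegral_mono' ?_ fun w hw => ?_
          · exact (measurableSet_le measurable_const measurable_norm).inter
              (measurableSet_le measurable_norm measurable_const)
          gcongr
          rw [← lintegral_const_mul' _ _ (by finiteness)]
          refine setLIntegral_mono' measurableSet_Ioi fun l hl => ?_
          have hl : 0 < l := hl
          have hw0 : 0 < ‖w‖ := zero_lt_one.trans_le hw.1
          have h1 : 1 ≤ 4 * (ENNReal.ofReal (l ^ 2) * (‖x + l • w - x‖ₑ ^ 2)⁻¹) := by
            rw [add_sub_cancel_left, ← ofReal_norm, norm_smul, Real.norm_of_nonneg hl.le,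
              ← ENNReal.ofReal_pow (by positivity), ← ENNReal.ofReal_inv_of_pos (by positivity),
              ← ENNReal.ofReal_mul (by positivity), show (4 : ℝ≥0∞) = ENNReal.ofReal 4 by norm_num,
              ← ENNReal.ofReal_mul (by norm_num), ENNReal.one_le_ofReal, mul_pow, mul_inv,
              ← mul_assoc (l ^ 2), mul_inv_cancel₀ (by positivity), one_mul, ← div_eq_mul_inv,
              one_le_div (by positivity)]
            nlinarith [hw.2]
          calc H (x + l • w) ≤ H (x + l • w) *
                (4 * (ENNReal.ofReal (l ^ 2) * (‖x + l • w - x‖ₑ ^ 2)⁻¹)) :=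
                le_mul_of_one_le_right zero_le h1
            _ = _ := by ring
      _ = L * (4 * ∫⁻ w in A, ∫⁻ l in Ioi (0 : ℝ), ENNReal.ofReal (l ^ 2) *
          (H (x + l • w) * (‖x + l • w - x‖ₑ ^ 2)⁻¹)) := by
          rw [lintegral_const_mul' _ _ ENNReal.ofReal_ne_top, lintegral_const_mul' _ _ (by finiteness)]
      _ ≤ L * (4 * ∫⁻ y, H y * (‖y - x‖ₑ ^ 2)⁻¹) := by
          refine mul_le_mul_right (mul_le_mul_right ?_ _) _
          exact lintegral_rays_le (F := fun y => H y * (‖y - x‖ₑ ^ 2)⁻¹) (by fun_prop) x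
      _ = _ := (mul_assoc _ _ _).symm
  calc ‖v (X s + ε • e)‖ₑ = a⁻¹ * (a * ‖v (X s + ε • e)‖ₑ) := by
        rw [← mul_assoc, ENNReal.inv_mul_cancel ha0 hat, one_mul]
    _ ≤ a⁻¹ * (L * 4 * ∫⁻ y, H y * (‖y - x‖ₑ ^ 2)⁻¹) := by gcongr
    _ = _ := (mul_assoc _ _ _).symm

end PointwiseBound

/-! ### The inequality for continuous fields. -/

section TraceBound

variable {X e₁ e₂ : ℝ → E3} {κmax cΓ : ℝ} {ε η : ℝ} {Φ v : E3 → E3}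

/-- Within `3 ε` of the curve `Φ` is anti-Lipschitz with constant `24`, and beyond `2 ε` it is the
identity; the two regions cover everything outside the thin tube. -/
theorem lintegral_sq_pulledGrad_le (hΦ : IsBlowUp X ε η Φ) (h : HasReach X (4 * ε))
    (hη : 0 < η) (hηε : η ≤ ε) (hv : ContDiffOn ℝ 1 v (outside X ε)) :
    ∫⁻ y, pulledGrad X η Φ v y ^ 2 ≤
      (24 ^ 3 + 1) * ∫⁻ y in outside X ε, ‖fderiv ℝ v y‖ₑ ^ 2 := by
  have hε : 0 < ε := hη.trans_le hηε
  have hd : Continuous fun x => Metric.infDist x (range X) := Metric.continuous_infDist_pt _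
  set G : E3 → ℝ≥0∞ := (outside X ε).indicator fun y => ‖fderiv ℝ v y‖ₑ ^ 2 with hG
  have hOm := (isOpen_outside X ε).measurableSet
  have hGm : Measurable G := by
    refine measurable_indicator_of_continuousOn hOm ?_
    exact (ENNReal.continuous_pow 2).comp_continuousOn
      (hv.continuousOn_fderiv_of_isOpen (isOpen_outside X ε) le_rfl).enorm
  set S : Set E3 := outside X η ∩ {x | Metric.infDist x (range X) ≤ 3 * ε} with hS
  have hSm : MeasurableSet S :=
    (isOpen_outside X η).measurableSet.inter (isClosed_le hd continuous_const).measurableSet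
  set T : Set E3 := {x | 2 * ε ≤ Metric.infDist x (range X)} with hT
  have hTm : MeasurableSet T := (isClosed_le continuous_const hd).measurableSet
  have hsq : ∀ y, pulledGrad X η Φ v y ^ 2 = (outside X η).indicator (fun y => G (Φ y)) y := by
    intro y
    by_cases hy : y ∈ outside X η
    · rw [pulledGrad, indicator_of_mem hy, indicator_of_mem hy, hG,
        indicator_of_mem (hΦ.mapsTo_outside h hη hηε hy)]
    · rw [pulledGrad, indicator_of_notMem hy, indicator_of_notMem hy, zero_pow two_ne_zero]
  have hnear : ∫⁻ y in S, G (Φ y) ≤ 24 ^ 3 * ∫⁻ y in outside X ε, ‖fderiv ℝ v y‖ₑ ^ 2 := by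
    have h1 := setLIntegral_comp_le_of_antilipschitzOn (K := 24) hSm (Φ := Φ) (U := univ)
      (fun x hx => (hΦ.continuousAt h hη hηε (le_of_lt hx.1)).continuousWithinAt) (mapsTo_univ _ _)
      (fun x hx y hy => hΦ.antilipschitz h hη hηε (le_of_lt hx.1) hx.2 hy.2) hGm
    rw [Measure.restrict_univ, hG, lintegral_indicator hOm] at h1
    exact_mod_cast h1
  have hfar : ∫⁻ y in T, G (Φ y) ≤ ∫⁻ y in outside X ε, ‖fderiv ℝ v y‖ₑ ^ 2 := by
    calc ∫⁻ y in T, G (Φ y) = ∫⁻ y in T, G y :=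
          setLIntegral_congr_fun hTm fun y hy => by rw [hΦ.eq_self hη.le hy]
      _ ≤ ∫⁻ y, G y := setLIntegral_le_lintegral _ _
      _ = _ := lintegral_indicator hOm _
  calc ∫⁻ y, pulledGrad X η Φ v y ^ 2 = ∫⁻ y in outside X η, G (Φ y) := by
        simp_rw [hsq]; exact lintegral_indicator (isOpen_outside X η).measurableSet _
    _ ≤ ∫⁻ y in S ∪ T, G (Φ y) := by
        refine lintegral_mono_set fun y hy => ?_
        rcases le_total (Metric.infDist y (range X)) (3 * ε) with h1 | h1
        · exact Or.inl ⟨hy, h1⟩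
        · right; show 2 * ε ≤ _; linarith
    _ ≤ (∫⁻ y in S, G (Φ y)) + ∫⁻ y in T, G (Φ y) := lintegral_union_le _ _ _
    _ ≤ _ := by rw [add_mul, one_mul]; exact add_le_add hnear hfar

/-- The trace inequality for fields that are `C¹` in the exterior domain and continuous up to its
boundary. -/
theorem exists_lintegral_sq_surface_le (cΓ : ℝ) (hcΓ : 0 < cΓ) :
    ∃ C : ℝ, 0 < C ∧ ∀ (κmax : ℝ) (X e₁ e₂ : ℝ → E3) (ε : ℝ), IsCenterline κmax cΓ X →
      IsFrame X e₁ e₂ → 0 < ε → HasReach X (4 * ε) → ∀ v : E3 → E3,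
      ContDiffOn ℝ 1 v (outside X ε) → ContinuousOn v (closure (outside X ε)) →
      ∫⁻ y in outside X ε, ‖v y‖ₑ ^ 6 < ⊤ →
      ∫⁻ q in surfaceDomain, ‖v (surface X e₁ e₂ ε q)‖ₑ ^ 2 ≤
        ENNReal.ofReal (C * |Real.log ε|) * ∫⁻ y in outside X ε, ‖fderiv ℝ v y‖ₑ ^ 2 := by
  obtain ⟨δ, hδ0, hδ1, C, hC, hpt⟩ := exists_pointwise_bound cΓ hcΓ
  obtain ⟨K, hK, hpot⟩ := exists_lintegral_inv_sq_mul_inv_sq_le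
  obtain ⟨M, hM, hsurf⟩ := exists_lintegral_inv_surface_le cΓ δ hcΓ hδ0 hδ1
  set N : ℝ≥0∞ := C ^ 2 * ((K + 1) * (24 ^ 3 + 1)) with hN
  have hNt : N ≠ ⊤ := by finiteness
  refine ⟨(N.toReal + 1) * M, by positivity, ?_⟩
  intro κmax X e₁ e₂ ε hX hF hε hR v hv hvc hv6
  obtain ⟨Φ, hΦ⟩ := hX.exists_isBlowUp hF ε (δ * ε)
  have hη0 : 0 < δ * ε := by positivity
  have hηε : δ * ε ≤ ε := by nlinarith
  set P := surface X e₁ e₂ (δ * ε) with hP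
  have hPm : Measurable P := (continuous_surface hX hF _).measurable
  set H := pulledGrad X (δ * ε) Φ v with hH
  have hHm : Measurable H := measurable_pulledGrad hΦ hR hη0 hηε hv
  have hμ : (volume : Measure (ℝ × ℝ)).restrict surfaceDomain ≠ 0 := by
    rw [ne_eq, Measure.restrict_eq_zero, Measure.volume_eq_prod, Measure.prod_prod, Real.volume_Ico,
      Real.volume_Ico]
    simp [Real.pi_pos]
  have hkm : Measurable (Function.uncurry fun (p : ℝ × ℝ) (y : E3) => (‖y - P p‖ₑ ^ 2)⁻¹) := by
    unfold Function.uncurry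
    fun_prop
  have hiter : ∀ p, ∫⁻ q in surfaceDomain, ∫⁻ y, (‖y - P p‖ₑ ^ 2)⁻¹ * (‖y - P q‖ₑ ^ 2)⁻¹ ≤
      (K + 1) * ENNReal.ofReal (M * |Real.log ε|) := by
    intro p
    calc _ ≤ ∫⁻ q in surfaceDomain, (K + 1) * ‖P p - P q‖ₑ⁻¹ :=
          lintegral_mono fun q => hpot _ _
      _ = (K + 1) * ∫⁻ q in surfaceDomain, ‖P p - P q‖ₑ⁻¹ :=
          lintegral_const_mul' _ _ (by finiteness)
      _ ≤ _ := by
          gcongr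
          exact hsurf κmax X e₁ e₂ ε hX hF hε hR p
  have hschur := lintegral_sq_lintegral_mul_le hμ hkm (fun p y => by simp)
    (by finiteness) hiter hHm
  calc _ ≤ ∫⁻ q in surfaceDomain, C ^ 2 * (∫⁻ y, H y * (‖y - P q‖ₑ ^ 2)⁻¹) ^ 2 := by
        refine lintegral_mono fun q => ?_
        rw [← mul_pow]
        gcongr
        exact hpt κmax X ε hX hε hR Φ hΦ v hv hvc hv6 q.1 _ (hF.isUnitNormal_eRho q.1 q.2)
    _ = C ^ 2 * ∫⁻ q in surfaceDomain, (∫⁻ y, H y * (‖y - P q‖ₑ ^ 2)⁻¹) ^ 2 :=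
        lintegral_const_mul' _ _ (by finiteness)
    _ ≤ C ^ 2 * ((K + 1) * ENNReal.ofReal (M * |Real.log ε|) *
        ((24 ^ 3 + 1) * ∫⁻ y in outside X ε, ‖fderiv ℝ v y‖ₑ ^ 2)) := by
        gcongr
        exact hschur.trans (by gcongr; exact lintegral_sq_pulledGrad_le hΦ hR hη0 hηε hv)
    _ = N * ENNReal.ofReal (M * |Real.log ε|) *
        ∫⁻ y in outside X ε, ‖fderiv ℝ v y‖ₑ ^ 2 := by rw [hN]; ring
    _ ≤ _ := by
        gcongr
        rw [mul_assoc (N.toReal + 1), ENNReal.ofReal_mul (p := N.toReal + 1) (by positivity)]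
        gcongr
        rw [← ENNReal.ofReal_toReal hNt]
        refine ENNReal.ofReal_le_ofReal ?_
        rw [ENNReal.toReal_ofReal ENNReal.toReal_nonneg]
        linarith

end TraceBound

/-! ### Passage to the trace: domains, Jacobian and norms. -/

section Limit

variable {X e₁ e₂ : ℝ → E3} {κmax cΓ ε : ℝ}

theorem outside_subset_exterior (hF : IsFrame X e₁ e₂) : outside X ε ⊆ exterior X e₁ e₂ ε := by
  intro x hx hxc
  have hcl : IsClosed {x : E3 | Metric.infDist x (range X) ≤ ε} :=
    isClosed_le (Metric.continuous_infDist_pt _) continuous_const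
  have hsub : body X e₁ e₂ ε ⊆ {x : E3 | Metric.infDist x (range X) ≤ ε} := by
    rintro _ ⟨s, ρ, θ, hρ, hρε, rfl⟩
    refine (IsCenterline.infDist_le (X := X) _ s).trans ?_
    rw [add_sub_cancel_left, norm_smul, (hF.isUnitNormal_eRho s θ).1, mul_one,
      Real.norm_of_nonneg hρ]
    exact hρε.le
  exact (not_le.2 (show ε < Metric.infDist x (range X) from hx)) (closure_minimal hsub hcl hxc)

theorem norm_fderiv_le_norm_classicalGrad (v : E3 → E3) (x : E3) :
    ‖fderiv ℝ v x‖ ≤ ‖classicalGrad v x‖ := by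
  refine ContinuousLinearMap.opNorm_le_bound _ (norm_nonneg _) fun h => ?_
  have hh : h = ∑ i : Fin 3, h i • EuclideanSpace.single i (1 : ℝ) := by
    ext j
    fin_cases j <;> simp [Fin.sum_univ_three]
  have h1 : ‖fderiv ℝ v x h‖ ≤ ∑ i : Fin 3,
      ‖fderiv ℝ v x (EuclideanSpace.single i 1)‖ * ‖h i‖ := by
    conv_lhs => rw [hh]
    rw [map_sum]
    refine (norm_sum_le _ _).trans (Finset.sum_le_sum fun i _ => ?_)
    rw [map_smul, norm_smul, mul_comm]
  refine h1.trans ((Real.sum_mul_le_sqrt_mul_sqrt _ _ _).trans_eq ?_)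
  rw [PiLp.norm_eq_of_L2, EuclideanSpace.norm_eq]
  rfl

/-- Reach `4 ε` gives `ε ⟨X'', e_ρ⟩ ≤ 1/4`. -/
theorem surfaceJacobian_pos (hX : IsCenterline κmax cΓ X) (hF : IsFrame X e₁ e₂) (hε : 0 < ε)
    (hR : HasReach X (4 * ε)) (p : ℝ × ℝ) : 0 < surfaceJacobian X e₁ e₂ ε p := by
  have h := hR.mul_inner_le hX (hF.isUnitNormal_eRho p.1 p.2)
  rw [eRho, inner_add_right, inner_smul_right, inner_smul_right] at h
  unfold surfaceJacobian
  refine mul_pos hε ?_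
  nlinarith

theorem continuous_surfaceJacobian (hX : IsCenterline κmax cΓ X) (hF : IsFrame X e₁ e₂) (ε : ℝ) :
    Continuous (surfaceJacobian X e₁ e₂ ε) := by
  have h0 : Continuous (deriv (deriv X)) :=
    (contDiff_succ_iff_deriv.1 (by simpa [one_add_one_eq_two] using hX.contDiff :
      ContDiff ℝ (1 + 1) X)).2.2.continuous_deriv le_rfl
  have h1 := hF.contDiff₁.continuous
  have h2 := hF.contDiff₂.continuous
  unfold surfaceJacobian
  fun_prop

/-- Almost-everywhere statements for the surface measure, in which the trace is defined, carry over
to Lebesgue measure in `(s, θ)`, in which the estimate is proved. -/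
theorem absolutelyContinuous_surfaceMeasure (hX : IsCenterline κmax cΓ X) (hF : IsFrame X e₁ e₂)
    (hε : 0 < ε) (hR : HasReach X (4 * ε)) :
    (volume : Measure (ℝ × ℝ)).restrict surfaceDomain ≪ surfaceMeasure X e₁ e₂ ε := by
  refine withDensity_absolutelyContinuous' ?_ ?_
  · have := (continuous_surfaceJacobian hX hF ε).measurable
    fun_prop
  · exact Eventually.of_forall fun p => by
      simpa using surfaceJacobian_pos hX hF hε hR p

theorem lintegral_sq_eq_eLpNorm_sq {α E : Type*} [MeasurableSpace α] {μ : Measure α}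
    [NormedAddCommGroup E] (f : α → E) : ∫⁻ x, ‖f x‖ₑ ^ 2 ∂μ = eLpNorm f 2 μ ^ 2 := by
  rw [eLpNorm_eq_lintegral_rpow_enorm_toReal (by norm_num) (by norm_num), ← ENNReal.rpow_natCast,
    ← ENNReal.rpow_mul]
  norm_num

theorem lintegral_surfaceDomain_fst {w : ℝ → E3}
    (hw : AEStronglyMeasurable (fun p : ℝ × ℝ => w p.1) (volume.restrict surfaceDomain)) :
    ∫⁻ p in surfaceDomain, ‖w p.1‖ₑ ^ 2 =
      ENNReal.ofReal (2 * Real.pi) * ∫⁻ s in Ico (0 : ℝ) 1, ‖w s‖ₑ ^ 2 := by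
  have hvol : (volume : Measure (ℝ × ℝ)).restrict surfaceDomain =
      (volume.restrict (Ico (0 : ℝ) 1)).prod (volume.restrict (Ico 0 (2 * Real.pi))) := by
    rw [Measure.volume_eq_prod, Measure.prod_restrict]
  rw [hvol] at hw ⊢
  rw [lintegral_prod _ (hw.enorm.pow_const 2)]
  simp only [lintegral_const, Measure.restrict_apply_univ, Real.volume_Ico, sub_zero]
  rw [lintegral_mul_const' _ _ ENNReal.ofReal_ne_top, mul_comm]

theorem surface_mem_closure_outside (hF : IsFrame X e₁ e₂) (hε : 0 < ε)
    (hR : HasReach X (4 * ε)) (p : ℝ × ℝ) : surface X e₁ e₂ ε p ∈ closure (outside X ε) := by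
  have hlim : Tendsto (fun ρ : ℝ => X p.1 + ρ • eRho e₁ e₂ p.1 p.2) (𝓝[>] ε)
      (𝓝 (surface X e₁ e₂ ε p)) := by
    have : ContinuousAt (fun ρ : ℝ => X p.1 + ρ • eRho e₁ e₂ p.1 p.2) ε := by fun_prop
    exact this.tendsto.mono_left nhdsWithin_le_nhds
  refine mem_closure_of_tendsto hlim ?_
  filter_upwards [Ioc_mem_nhdsGT (show ε < 4 * ε by linarith)] with ρ hρ
  show ε < Metric.infDist _ _
  rw [hR.infDist_eq (hF.isUnitNormal_eRho _ _) (hε.le.trans hρ.1.le) hρ.2]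
  exact hρ.1

theorem lintegral_pow_six_lt_top {α E : Type*} [MeasurableSpace α] {μ : Measure α}
    [NormedAddCommGroup E] {f : α → E} (hf : MemLp f 6 μ) : ∫⁻ x, ‖f x‖ₑ ^ 6 ∂μ < ⊤ := by
  have h := lintegral_rpow_enorm_lt_top_of_eLpNorm_lt_top (p := 6) (by norm_num) (by norm_num)
    hf.eLpNorm_lt_top
  refine lt_of_eq_of_lt (lintegral_congr fun x => ?_) h
  rw [← ENNReal.rpow_natCast]
  norm_num

theorem eLpNorm_surface_le {C : ℝ} (hF : IsFrame X e₁ e₂) {v : E3 → E3}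
    (h : ∫⁻ q in surfaceDomain, ‖v (surface X e₁ e₂ ε q)‖ₑ ^ 2 ≤
      ENNReal.ofReal (C * |Real.log ε|) * ∫⁻ y in outside X ε, ‖fderiv ℝ v y‖ₑ ^ 2) :
    eLpNorm (fun q => v (surface X e₁ e₂ ε q)) 2 (volume.restrict surfaceDomain) ≤
      ENNReal.ofReal (√(C * |Real.log ε|)) *
        eLpNorm (classicalGrad v) 2 (volume.restrict (exterior X e₁ e₂ ε)) := by
  have h1 : ∫⁻ y in outside X ε, ‖fderiv ℝ v y‖ₑ ^ 2 ≤
      ∫⁻ y in exterior X e₁ e₂ ε, ‖classicalGrad v y‖ₑ ^ 2 := by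
    refine (lintegral_mono_set (outside_subset_exterior hF)).trans (lintegral_mono fun y => ?_)
    gcongr
    exact enorm_le_iff_norm_le.2 (norm_fderiv_le_norm_classicalGrad v y)
  rw [← ENNReal.pow_le_pow_left_iff two_ne_zero, mul_pow, ← ENNReal.ofReal_pow (Real.sqrt_nonneg _),
    ← lintegral_sq_eq_eLpNorm_sq, ← lintegral_sq_eq_eLpNorm_sq]
  refine h.trans ?_
  gcongr
  rcases le_total 0 (C * |Real.log ε|) with h0 | h0
  · rw [Real.sq_sqrt h0]
  · exact h0.trans (sq_nonneg _)

end Limit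

end SlenderBody

/-! ### Approximation and conclusion. -/

open SlenderBody in
theorem mainTheorem3 (κmax cΓ : ℝ) (hcΓ : 0 < cΓ) :
    ∃ cκ : ℝ, 0 < cκ ∧
      ∀ X e₁ e₂ : ℝ → SlenderBody.E3,
        SlenderBody.IsCenterline κmax cΓ X →
        SlenderBody.IsFrame X e₁ e₂ →
        ∀ rmax : ℝ, SlenderBody.IsTubeRadius X e₁ e₂ rmax →
        ∀ ε : ℝ, 0 < ε → ε < rmax / 4 →
        ∀ (u : SlenderBody.E3 → SlenderBody.E3) (G : SlenderBody.E3 → SlenderBody.GradE3)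
          (w : ℝ → SlenderBody.E3),
          SlenderBody.MemA X e₁ e₂ ε u G w →
          eLpNorm w 2 (volume.restrict (Ico (0 : ℝ) 1)) ≤
            ENNReal.ofReal (cκ * |Real.log ε| ^ (1 / 2 : ℝ)) *
              eLpNorm G 2 (volume.restrict (SlenderBody.exterior X e₁ e₂ ε)) := by
  obtain ⟨C, hC, hbound⟩ := exists_lintegral_sq_surface_le cΓ hcΓ
  refine ⟨√C, Real.sqrt_pos.2 hC, ?_⟩
  rintro X e₁ e₂ hX hF rmax hr ε hε hεr u G w ⟨g, ⟨hu, hg, v, hv1, hvc, hvD, hvG, hvg⟩, hgw⟩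
  have hR : HasReach X (4 * ε) := hr.hasReach hX hF (by positivity) (by linarith)
  have hext := outside_subset_exterior (ε := ε) hF
  have hac := absolutelyContinuous_surfaceMeasure hX hF hε hR
  set c := ENNReal.ofReal (√(C * |Real.log ε|)) with hc
  have hvk : ∀ k, eLpNorm (fun q => v k (surface X e₁ e₂ ε q)) 2 (volume.restrict surfaceDomain) ≤
      c * eLpNorm (classicalGrad (v k)) 2 (volume.restrict (exterior X e₁ e₂ ε)) := fun k =>
    eLpNorm_surface_le hF <| hbound κmax X e₁ e₂ ε hX hF hε hR (v k) ((hv1 k).mono hext)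
      ((hvc k).mono (closure_mono hext))
      ((lintegral_mono_set hext).trans_lt (lintegral_pow_six_lt_top (hvD k).memLp))
  have hvcont : ∀ k, Continuous fun q => v k (surface X e₁ e₂ ε q) := fun k =>
    (hvc k).comp_continuous (continuous_surface hX hF ε) fun q =>
      closure_mono hext (surface_mem_closure_outside hF hε hR q)
  -- Almost-everywhere convergence of a subsequence suffices, since the bound passes to the limit by
  -- Fatou; no quantitative comparison of the two measures is needed.
  obtain ⟨n, hn, hlim⟩ := (tendstoInMeasure_of_tendsto_eLpNorm (by norm_num)
    (fun k => (hvcont k).aestronglyMeasurable) hg.1 hvg).exists_seq_tendsto_ae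
  have hlimw : ∀ᵐ p ∂(volume.restrict surfaceDomain),
      Tendsto (fun j => v (n j) (surface X e₁ e₂ ε p)) atTop (𝓝 (w p.1)) := by
    filter_upwards [hac.ae_le hlim, hac.ae_le hgw] with p hp hpw
    rwa [← hpw]
  have hwm : AEStronglyMeasurable (fun p : ℝ × ℝ => w p.1) (volume.restrict surfaceDomain) :=
    (hg.1.mono_ac hac).congr (hac.ae_le hgw)
  have hgrad : ∀ k, c * eLpNorm (classicalGrad (v k)) 2 (volume.restrict (exterior X e₁ e₂ ε)) ≤
      c * (eLpNorm (classicalGrad (v k) - G) 2 (volume.restrict (exterior X e₁ e₂ ε)) +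
        eLpNorm G 2 (volume.restrict (exterior X e₁ e₂ ε))) := by
    intro k
    gcongr
    have := eLpNorm_add_le ((hvD k).grad_memLp.1.sub hu.grad_memLp.1) hu.grad_memLp.1 (p := 2)
      (by norm_num)
    rwa [sub_add_cancel] at this
  have hrhs : Tendsto (fun j => c * (eLpNorm (classicalGrad (v (n j)) - G) 2
      (volume.restrict (exterior X e₁ e₂ ε)) +
        eLpNorm G 2 (volume.restrict (exterior X e₁ e₂ ε)))) atTop
      (𝓝 (c * eLpNorm G 2 (volume.restrict (exterior X e₁ e₂ ε)))) := by
    have h1 := (hvG.comp hn.tendsto_atTop).add_const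
      (eLpNorm G 2 (volume.restrict (exterior X e₁ e₂ ε)))
    rw [zero_add] at h1
    exact ENNReal.Tendsto.const_mul h1 (Or.inr ENNReal.ofReal_ne_top)
  have hw2 : eLpNorm (fun p : ℝ × ℝ => w p.1) 2 (volume.restrict surfaceDomain) ≤
      c * eLpNorm G 2 (volume.restrict (exterior X e₁ e₂ ε)) := by
    refine (Lp.eLpNorm_lim_le_liminf_eLpNorm (fun j => (hvcont (n j)).aestronglyMeasurable) _
      hlimw).trans ?_
    rw [← hrhs.liminf_eq]
    exact liminf_le_liminf (Eventually.of_forall fun j => (hvk (n j)).trans (hgrad (n j)))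
  have hcc : c = ENNReal.ofReal (√C * |Real.log ε| ^ (1 / 2 : ℝ)) := by
    rw [hc, Real.sqrt_mul hC.le, ← Real.sqrt_eq_rpow]
  rw [← hcc]
  refine le_trans ?_ hw2
  rw [← ENNReal.pow_le_pow_left_iff two_ne_zero, ← lintegral_sq_eq_eLpNorm_sq,
    ← lintegral_sq_eq_eLpNorm_sq, lintegral_surfaceDomain_fst hwm]
  -- Integration over the angle produced a factor `2 π ≥ 1`, which is dropped.
  refine le_mul_of_one_le_left zero_le ?_
  rw [ENNReal.one_le_ofReal]
  linarith [Real.pi_gt_three]
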